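/- A virtual knot $K$ is an equivalence class of signed oriented Gauss codes of one-component diagrams, up to relabelling, change of base point and the Reidemeister moves. A crossing of a diagram is odd if an odd number of letters lies between its two occurrences in the Gauss code, and even otherwise. For a diagram $D$ with $n\ge 1$ real crossings, take one generator for each of the $2n$ arcs between consecutive passages through crossings and, at each crossing of sign $\varepsilon=\pm1$, the two relations $$o_{\rm out}=s^{\varepsilon}o_{\rm in},\qquad u_{\rm out}=t^{\varepsilon}u_{\rm in}+(1-s^{\varepsilon}t^{\varepsilon})\,o_{\rm in}$$ if the crossing is even, and $$o_{\rm out}=z^{\varepsilon}o_{\rm in},\qquad u_{\rm out}=z^{-\varepsilon}u_{\rm in}$$ if it is odd, where $o_{\rm in},o_{\rm out}$ (resp. $u_{\rm in},u_{\rm out}$) are the arcs entering and leaving the over-passage (resp. under-passage). The z-Parity Alexander polynomial of $K$ is the determinant in $\mathbb{Z}[s^{\pm1},t^{\pm1},z^{\pm1}]$ of the $2n\times 2n$ matrix of these relations for any diagram $D$ of $K$ (and $0$ for the diagram without crossings); it is taken up to multiples $\pm s^at^b$ with $a,b\in\mathbb{Z}$. **Theorem.** Let $K$ be a virtual knot,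 let $n_o$ be the minimum number of odd crossings over all diagrams of $K$, let $z^{e_{\max}}$ and $z^{e_{\min}}$ be the highest and the lowest power of $z$ that appear in the z-Parity Alexander polynomial of $K$, and let $e=\max(|e_{\max}|,|e_{\min}|)$, that is, the largest absolute value of an exponent of $z$ that appears in it ($e=0$ if the polynomial is zero). Then $e\le n_o$, and $e+1\le n_o$ if $e$ is odd. -/

import Mathlib

/-- One term of a signed oriented Gauss code: a passage, over or under, through the crossing with
the given label, whose sign is `1` (positive) or `-1` (negative). -/
@[ext] structure GaussLetter where
  isOver : Bool
  label : ℕ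
  sign : ℤˣ
deriving DecidableEq

/-- A signed oriented Gauss code of a one-component diagram, read from some base point: each label
that occurs, occurs exactly twice, once as an over- and once as an under-passage, with the same
sign. The empty word is the code of the diagram without real crossings. -/
structure GaussCode where
  word : List GaussLetter
  valid : ∀ c : ℕ, word.filter (fun x => x.label = c) = [] ∨
    ∃ ε : ℤˣ, (word.filter (fun x => x.label = c)).Perm [⟨true, c, ε⟩, ⟨false, c, ε⟩]

/-- The two-letter word in which `x` comes before `y` if `o = 1`, and after `y` if `o = -1`. -/
def orderedPair (o : ℤˣ) (x y : GaussLetter) : List GaussLetter :=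
  if o = 1 then [x, y] else [y, x]

/-- The three strands of a third Reidemeister move: the top strand meets the middle strand at the
crossing `a` and the bottom strand at `b`; the middle and the bottom strand meet at `c`.
Here `o₁ = 1` iff the top strand passes `a` before `b`, `o₂ = 1` iff the middle strand passes `a`
before `c`, `o₃ = 1` iff the bottom strand passes `b` before `c`, and `δ = 1` iff the triangle `abc`
is oriented counterclockwise; `δ * o₁ * o₂`, `δ * o₁ * o₃` and `δ * o₂ * o₃` are then the signs of
`a`, `b` and `c`. -/
def topStrand (δ o₁ o₂ o₃ : ℤˣ) (a b : ℕ) : List GaussLetter :=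
  orderedPair o₁ ⟨true, a, δ * o₁ * o₂⟩ ⟨true, b, δ * o₁ * o₃⟩

/-- The middle strand, with the conventions of `topStrand`. -/
def middleStrand (δ o₁ o₂ o₃ : ℤˣ) (a c : ℕ) : List GaussLetter :=
  orderedPair o₂ ⟨false, a, δ * o₁ * o₂⟩ ⟨true, c, δ * o₂ * o₃⟩

/-- The bottom strand, with the conventions of `topStrand`. -/
def bottomStrand (δ o₁ o₂ o₃ : ℤˣ) (b c : ℕ) : List GaussLetter :=
  orderedPair o₃ ⟨false, b, δ * o₁ * o₃⟩ ⟨false, c, δ * o₂ * o₃⟩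

/-- Change of labels, change of base point, and the Reidemeister moves on Gauss codes. The virtual
Reidemeister moves do not change the Gauss code. -/
inductive GaussMove : List GaussLetter → List GaussLetter → Prop
  | relabel (φ : Equiv.Perm ℕ) (w : List GaussLetter) :
      GaussMove w (w.map fun x => ⟨x.isOver, φ x.label, x.sign⟩)
  | rotate (u v : List GaussLetter) : GaussMove (u ++ v) (v ++ u)
  | reidemeister1 (o : Bool) (c : ℕ) (ε : ℤˣ) (w : List GaussLetter) :
      GaussMove w ([⟨o, c, ε⟩, ⟨!o, c, ε⟩] ++ w)
  | reidemeister2 (c d : ℕ) (ε o : ℤˣ) (u v : List GaussLetter) :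
      GaussMove (u ++ v) ([⟨true, c, ε⟩, ⟨true, d, -ε⟩] ++ u ++
        orderedPair o ⟨false, c, ε⟩ ⟨false, d, -ε⟩ ++ v)
  | reidemeister3 (δ o₁ o₂ o₃ : ℤˣ) (a b c : ℕ) (u v w : List GaussLetter) :
      GaussMove
        (topStrand δ o₁ o₂ o₃ a b ++ u ++ middleStrand δ o₁ o₂ o₃ a c ++ v ++
          bottomStrand δ o₁ o₂ o₃ b c ++ w)
        (topStrand δ (-o₁) (-o₂) (-o₃) a b ++ u ++ middleStrand δ (-o₁) (-o₂) (-o₃) a c ++ v ++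
          bottomStrand δ (-o₁) (-o₂) (-o₃) b c ++ w)
  | reidemeister3' (δ o₁ o₂ o₃ : ℤˣ) (a b c : ℕ) (u v w : List GaussLetter) :
      GaussMove
        (topStrand δ o₁ o₂ o₃ a b ++ u ++ bottomStrand δ o₁ o₂ o₃ b c ++ v ++
          middleStrand δ o₁ o₂ o₃ a c ++ w)
        (topStrand δ (-o₁) (-o₂) (-o₃) a b ++ u ++ bottomStrand δ (-o₁) (-o₂) (-o₃) b c ++ v ++
          middleStrand δ (-o₁) (-o₂) (-o₃) a c ++ w)

/-- An (oriented) virtual knot: a Gauss code up to the equivalence relation generated by the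
moves between Gauss codes. -/
def VirtualKnot : Type := Quot fun D D' : GaussCode => GaussMove D.word D'.word

/-- `D` is (the Gauss code of) a diagram of `K`. -/
def VirtualKnot.IsDiagram (K : VirtualKnot) (D : GaussCode) : Prop :=
  Quot.mk (fun D D' : GaussCode => GaussMove D.word D'.word) D = K

/-- The crossing `c` is odd: an odd number of letters lies between its two occurrences. -/
def IsOddCrossing (w : List GaussLetter) (c : ℕ) : Prop :=
  ∃ i j : Fin w.length, i < j ∧ (w.get i).label = c ∧ (w.get j).label = c ∧
    Odd ((j : ℕ) - (i : ℕ) - 1)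

instance (w : List GaussLetter) (c : ℕ) : Decidable (IsOddCrossing w c) := by
  unfold IsOddCrossing; infer_instance

/-- The number of odd crossings of a diagram. -/
def GaussCode.numOdd (D : GaussCode) : ℕ :=
  ((D.word.map GaussLetter.label).toFinset.filter fun c => IsOddCrossing D.word c).card

/-- The minimum number of odd crossings over all diagrams of `K`. -/
noncomputable def VirtualKnot.minOdd (K : VirtualKnot) : ℕ :=
  sInf {n : ℕ | ∃ D : GaussCode, K.IsDiagram D ∧ D.numOdd = n}

/-- The matrix of relations of the z-parity Alexander biquandle. The arc that leads into the passage
`x` is identified with `x`, so the arc that leaves `x` is the cyclically next letter of `w`. The row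
of `x` expresses the outgoing arc at `x` minus itself as zero: at an even crossing of sign `ε`,
`out_over = s ^ ε * in_over` and `out_under = t ^ ε * in_under + (1 - s ^ ε * t ^ ε) * in_over`;
at an odd crossing `out_over = z ^ ε * in_over` and `out_under = z ^ (-ε) * in_under`. -/
def relationMatrix {R : Type*} [CommRing R] (s t z : Rˣ) (w : List GaussLetter) :
    Matrix {x // x ∈ w} {x // x ∈ w} R :=
  Matrix.of fun x y =>
    (if IsOddCrossing w x.1.label then
      (if x.1.isOver then
        (if y = x then ((z ^ (x.1.sign : ℤ) : Rˣ) : R) else 0)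
      else
        (if y = x then ((z ^ (-(x.1.sign : ℤ)) : Rˣ) : R) else 0))
    else
      (if x.1.isOver then
        (if y = x then ((s ^ (x.1.sign : ℤ) : Rˣ) : R) else 0)
      else
        (if y = x then ((t ^ (x.1.sign : ℤ) : Rˣ) : R) else 0) +
        (if y.1.isOver ∧ y.1.label = x.1.label then
          1 - ((s ^ (x.1.sign : ℤ) * t ^ (x.1.sign : ℤ) : Rˣ) : R) else 0)))
    - (if y.1 = w.next x.1 x.2 then 1 else 0)

open scoped LaurentPolynomial

/-- The ring `ℤ[s^±1, t^±1, z^±1]`, as Laurent polynomials in `z` over `ℤ[s^±1][t^±1]`. -/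
abbrev LaurentSTZ : Type := ℤ[T;T⁻¹][T;T⁻¹][T;T⁻¹]

/-- The variable of a Laurent polynomial ring, as a unit. -/
noncomputable def laurentVar (R : Type*) [CommRing R] : (R[T;T⁻¹])ˣ where
  val := LaurentPolynomial.T 1
  inv := LaurentPolynomial.T (-1)
  val_inv := by rw [← LaurentPolynomial.T_add, add_neg_cancel, LaurentPolynomial.T_zero]
  inv_val := by rw [← LaurentPolynomial.T_add, neg_add_cancel, LaurentPolynomial.T_zero]

noncomputable def varZ : LaurentSTZˣ := laurentVar _

noncomputable def varT : LaurentSTZˣ :=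
  Units.map (LaurentPolynomial.C : ℤ[T;T⁻¹][T;T⁻¹] →+* LaurentSTZ).toMonoidHom (laurentVar _)

noncomputable def varS : LaurentSTZˣ :=
  Units.map (LaurentPolynomial.C : ℤ[T;T⁻¹][T;T⁻¹] →+* LaurentSTZ).toMonoidHom
    (Units.map (LaurentPolynomial.C : ℤ[T;T⁻¹] →+* ℤ[T;T⁻¹][T;T⁻¹]).toMonoidHom (laurentVar _))

/-- The z-parity Alexander polynomial computed from a diagram: the determinant of the matrix of
relations. A diagram without real crossings has one arc and no relation, so that the module it
presents is free of rank one and the polynomial is zero. -/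
noncomputable def GaussCode.zParityPolynomial (D : GaussCode) : LaurentSTZ :=
  if D.word = [] then 0 else (relationMatrix varS varT varZ D.word).det

/-- `f` is the z-parity Alexander polynomial of `K`, which is unique up to multiples
`± s ^ a * t ^ b`. -/
def VirtualKnot.IsZParityAlexanderPolynomial (K : VirtualKnot) (f : LaurentSTZ) : Prop :=
  ∃ D : GaussCode, K.IsDiagram D ∧ ∃ (ε : ℤˣ) (a b : ℤ),
    f = ((ε : ℤ) : LaurentSTZ) * ((varS ^ a * varT ^ b : LaurentSTZˣ) : LaurentSTZ) *
      D.zParityPolynomial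

/-- The largest absolute value of an exponent of `z` in `f` (zero if `f = 0`). -/
noncomputable def zExponent (f : LaurentSTZ) : ℕ := f.coeff.support.sup Int.natAbs

/-! ### Determinants of cyclic systems and elimination of one arc. -/

section CyclicDeterminant

open Matrix

/-! The bound comes from one diagram, and invariance carries it to the knot. The variable `z` enters
the matrix only in the rows of odd crossings. Each odd crossing has one row containing `z` and one
containing `z⁻¹`, so every term of the determinant has its `z`-exponent between `-numOdd` and
`numOdd` (`GaussCode.zExponent_le_numOdd`). Evaluated on a diagram with the fewest odd crossings,
this gives `e ≤ n_o`, provided the exponents of `z` do not depend on the diagram. The second claim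
follows because every diagram has an even number of odd crossings (`GaussCode.even_numOdd`).

Most of the work is invariance up to factors `s ^ a * t ^ b` (`relationDet_gaussMove`). The matrix
has the form `T - N`, with `N` the cyclic successor and `T` the local coefficients at the crossings.
Its determinant can be computed by eliminating arcs one at a time (`cyclicDet_eliminate`). For a
Reidemeister move the arcs inside the moving region are eliminated. What remains is an identity
action in the first two moves, and equal actions of the two triangles in the third. These local
identities need facts about parity: a curl is even, the two crossings of a bigon have equal parity,
and a triangle has zero or two odd crossings. Parity is handled through `positionSum`, the sum
modulo two of the two positions of a label, which is easy to follow under concatenation. -/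

theorem Matrix.det_eliminate {R ι : Type*} [CommRing R] [Fintype ι] [DecidableEq ι]
    (M : Matrix ι ι R) (f g : ι) (hfg : f ≠ g) (u : R) (hu : u * M f g = -1) :
    M.det = - M f g * (Matrix.of fun x y : {x // x ≠ g} =>
      if x.1 = f then M g y + M g g * u * M f y else M x y + M x g * u * M f y).det := by
  -- Swapping the rows `f` and `g` costs a sign and puts the unit `M f g` on the diagonal at `g`.
  -- The remaining matrix is the Schur complement of that entry, whose inverse is `-u`.
  have h1 := det_permute (Equiv.swap f g) M
  rw [Equiv.Perm.sign_swap hfg] at h1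
  set M1 := M.submatrix (Equiv.swap f g) id with hM1
  have h2 := det_submatrix_equiv_self (Equiv.sumCompl fun x : ι => x ≠ g) M1
  have h3 : M1.submatrix (Equiv.sumCompl fun x : ι => x ≠ g) (Equiv.sumCompl fun x : ι => x ≠ g)
      = fromBlocks (M1.toBlock (· ≠ g) (· ≠ g)) (M1.toBlock (· ≠ g) (fun x => ¬ x ≠ g))
        (M1.toBlock (fun x => ¬ x ≠ g) (· ≠ g))
        (M1.toBlock (fun x => ¬ x ≠ g) (fun x => ¬ x ≠ g)) := by
    ext (i | i) (j | j) <;> rfl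
  let D := M1.toBlock (fun x => ¬ x ≠ g) (fun x => ¬ x ≠ g)
  have : Unique {x // ¬ x ≠ g} := ⟨⟨⟨g, by simp⟩⟩, fun x => Subtype.ext (by simpa using x.2)⟩
  have hd : (default : {x // ¬ x ≠ g}) = ⟨g, by simp⟩ := Subsingleton.elim _ _
  have hD : ∀ i j, D i j = M f g := by
    intro i j
    rw [Subsingleton.elim i default, Subsingleton.elim j default, hd]
    simp [D, hM1, toBlock_apply]
  have hinv : (Matrix.of fun _ _ => -u : Matrix {x // ¬ x ≠ g} {x // ¬ x ≠ g} R) * D = 1 := by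
    ext i j
    rw [Subsingleton.elim i j]
    simp only [mul_apply, Fintype.sum_unique, of_apply, hD, one_apply_eq]
    linear_combination -hu
  let _ : Invertible D := invertibleOfLeftInverse D _ hinv
  have hinv' : ⅟D = Matrix.of fun _ _ => -u := invOf_eq_left_inv hinv
  rw [h3, det_fromBlocks₂₂, hinv'] at h2
  have hdet : D.det = M f g := by rw [det_unique, hD]
  have : M.det = - M1.det := by rw [h1]; simp
  rw [this, ← h2, hdet, neg_mul]
  congr 3
  ext x y
  simp only [Matrix.sub_apply, mul_apply, Fintype.sum_unique, of_apply, toBlock_apply, hd, hM1, submatrix_apply, id,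
    Equiv.swap_apply_right]
  split_ifs with hx
  · rw [hx, Equiv.swap_apply_left]; ring
  · rw [Equiv.swap_apply_of_ne_of_ne hx x.2]; ring

variable {α R : Type*} [DecidableEq α] [CommRing R]

/-- The matrix `T - N`, where `N` is the matrix of the cyclic successor on the letters of `w`. -/
def cyclicMatrix (T : α → α → R) (w : List α) : Matrix {x // x ∈ w} {x // x ∈ w} R :=
  Matrix.of fun x y => T x.1 y.1 - if y.1 = w.next x.1 x.2 then 1 else 0

/-- The determinant of `cyclicMatrix`, with the value zero at the empty word. -/
def cyclicDet (T : α → α → R) (w : List α) : R :=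
  if w = [] then 0 else (cyclicMatrix T w).det

theorem cyclicDet_nil (T : α → α → R) : cyclicDet T [] = 0 := if_pos rfl

theorem cyclicDet_congr {T T' : α → α → R} {w : List α}
    (h : ∀ x ∈ w, ∀ y ∈ w, T x y = T' x y) : cyclicDet T w = cyclicDet T' w := by
  unfold cyclicDet
  congr 2
  ext x y
  simp [cyclicMatrix, h x.1 x.2 y.1 y.2]

theorem cyclicDet_of_equiv {β : Type*} [DecidableEq β] {T : α → α → R} {T' : β → β → R}
    {w : List α} {w' : List β}
    (e : {x // x ∈ w} ≃ {x // x ∈ w'}) (hT : ∀ x y, T' (e x).1 (e y).1 = T x.1 y.1)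
    (hN : ∀ x, w'.next (e x).1 (e x).2 = (e ⟨w.next x.1 x.2, w.next_mem _ _⟩).1) :
    cyclicDet T w = cyclicDet T' w' := by
  have hnil : w = [] ↔ w' = [] := by
    simp only [List.eq_nil_iff_forall_not_mem]
    exact ⟨fun h x hx => h _ (e.symm ⟨x, hx⟩).2, fun h x hx => h _ (e ⟨x, hx⟩).2⟩
  unfold cyclicDet
  simp only [hnil]
  congr 1
  rw [← det_submatrix_equiv_self e]
  congr 1
  ext x y
  simp only [cyclicMatrix, of_apply, submatrix_apply, hT, hN, Subtype.val_inj, e.injective.eq_iff]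
  simp only [Subtype.ext_iff]

theorem cyclicDet_isRotated (T : α → α → R) {w w' : List α} (hw : w.Nodup) (h : w ~r w') :
    cyclicDet T w = cyclicDet T w' :=
  cyclicDet_of_equiv (Equiv.subtypeEquivRight fun _ => h.mem_iff) (fun _ _ => rfl)
    fun x => (List.isRotated_next_eq h hw x.2).symm

theorem List.nextOr_map {β : Type*} [DecidableEq β] {φ : α → β} (hφ : Function.Injective φ)
    (w : List α) (x d : α) : (w.map φ).nextOr (φ x) (φ d) = φ (w.nextOr x d) := by
  induction w with
  | nil => rfl
  | cons a w ih =>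
    cases w with
    | nil => rfl
    | cons b w =>
      simp only [List.map_cons, List.nextOr, hφ.eq_iff] at ih ⊢
      split_ifs with h
      · rfl
      · exact ih

theorem cyclicDet_map {β : Type*} [DecidableEq β] {φ : α → β} (hφ : Function.Injective φ)
    (T : β → β → R) (w : List α) :
    cyclicDet T (w.map φ) = cyclicDet (fun x y => T (φ x) (φ y)) w := by
  symm
  refine cyclicDet_of_equiv (Equiv.ofBijective
    (fun x : {x // x ∈ w} => (⟨φ x.1, List.mem_map_of_mem x.2⟩ : {y // y ∈ w.map φ})) ⟨?_, ?_⟩)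
    (fun _ _ => rfl) ?_
  · intro x y h
    exact Subtype.ext (hφ (Subtype.ext_iff.mp h))
  · rintro ⟨y, hy⟩
    obtain ⟨x, hx, rfl⟩ := List.mem_map.mp hy
    exact ⟨⟨x, hx⟩, rfl⟩
  · rintro ⟨x, hx⟩
    cases w with
    | nil => simp at hx
    | cons a w => exact List.nextOr_map hφ (a :: w) x a

/-- The coefficients that remain when the arc into `g`, which leaves `f`, is expressed by the
other arcs and eliminated; `u` is the inverse of `1 - T f g`. -/
def eliminate (f g : α) (u : R) (T : α → α → R) (x y : α) : R :=
  if x = f then T g y + T g g * u * T f y else T x y + T x g * u * T f y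

theorem List.nextOr_cons_cons_eq {f g x : α} {w : List α} (hw : (f :: g :: w).Nodup)
    (hx : x ∈ w) : (f :: g :: w).nextOr x f = (f :: w).nextOr x f := by
  have hxf : x ≠ f := by rintro rfl; simp_all
  have hxg : x ≠ g := by rintro rfl; simp_all
  rw [List.nextOr_cons_of_ne _ _ _ _ hxf, List.nextOr_cons_of_ne _ _ _ _ hxg,
    List.nextOr_cons_of_ne _ _ _ _ hxf]

theorem List.nextOr_cons_self_eq {f g d : α} {w : List α} :
    (g :: w).nextOr g d = (f :: w).nextOr f d := by
  cases w with
  | nil => rfl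
  | cons a w => simp [List.nextOr]

/-- The equation of `f` gives `1 - T f g` times the arc into `g` in terms of the other arcs.
Substituting merges the passages `f` and `g` into one, still called `f`, which is entered at `f` and
left where `g` was left. -/
theorem cyclicDet_eliminate (T : α → α → R) {f g : α} {w : List α} (hw : (f :: g :: w).Nodup)
    (u : R) (hu : u * (1 - T f g) = 1) :
    cyclicDet T (f :: g :: w) = (1 - T f g) * cyclicDet (eliminate f g u T) (f :: w) := by
  have hfg : f ≠ g := by rintro rfl; simp at hw
  have hgw : g ∉ w := by simp at hw; tauto
  have hfw : f ∉ w := by simp at hw; tauto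
  have hw' : (f :: w).Nodup := by simp at hw ⊢; tauto
  let F : {x // x ∈ f :: g :: w} := ⟨f, by simp⟩
  let G : {x // x ∈ f :: g :: w} := ⟨g, by simp⟩
  have nf : (f :: g :: w).next f F.2 = g := List.next_cons_cons_eq ..
  -- In a word without repetition the successor map is injective, so `f` is the only row with a
  -- successor entry in column `g`.
  have hnx : ∀ x : {x // x ∈ f :: g :: w}, (f :: g :: w).next x.1 x.2 = g → x = F := by
    intro x hx
    have h1 := List.prev_next (f :: g :: w) hw x.1 x.2
    have h2 := List.prev_next (f :: g :: w) hw F.1 F.2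
    simp only [hx] at h1
    simp only [F, nf] at h2
    exact Subtype.ext (h1.symm.trans h2)
  have hMfg : cyclicMatrix T (f :: g :: w) F G = T f g - 1 := by
    simp [cyclicMatrix, F, G, nf]
  unfold cyclicDet
  rw [if_neg (by simp), if_neg (by simp), Matrix.det_eliminate _ F G
    (fun h => hfg (Subtype.ext_iff.mp h)) u (by rw [hMfg]; linear_combination -hu), hMfg, neg_sub]
  congr 1
  let e : {x // x ∈ f :: w} ≃ {x : {x // x ∈ f :: g :: w} // x ≠ G} :=
    { toFun := fun x => ⟨⟨x.1, by have := x.2; simp at this ⊢; tauto⟩, by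
        have := x.2
        simp only [ne_eq, G, Subtype.mk.injEq]
        rintro h
        simp only [h, List.mem_cons, hfg.symm, hgw, or_self] at this⟩
      invFun := fun x => ⟨x.1.1, by
        have h1 := x.1.2
        have h2 : x.1.1 ≠ g := fun h => x.2 (Subtype.ext h)
        simp only [List.mem_cons] at h1 ⊢
        tauto⟩
      left_inv := fun x => rfl
      right_inv := fun x => rfl }
  rw [← det_submatrix_equiv_self e]
  congr 1
  ext x y
  have hyg : y.1 ≠ g := fun h => (e y).2 (Subtype.ext h)
  simp only [submatrix_apply, of_apply]
  have ex : ((e x).1 = F) ↔ x.1 = f := by simp [e, F]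
  simp only [ex]
  by_cases hx : x.1 = f
  · have hgg : ¬ (g = (f :: g :: w).next g G.2) := fun h =>
      hfg (Subtype.ext_iff.mp (hnx G h.symm)).symm
    have hn : (f :: w).next x.1 x.2 = (f :: g :: w).next g G.2 := by
      simp only [List.next, List.get, hx]
      rw [List.nextOr_cons_of_ne _ _ _ _ hfg.symm]
      exact List.nextOr_cons_self_eq.symm
    simp only [if_pos hx, cyclicMatrix, of_apply, eliminate, hn, F, G, nf, e, Equiv.coe_fn_mk,
      if_neg hgg, if_neg hyg]
    ring
  · have hxw : x.1 ∈ w := by have := x.2; simp only [List.mem_cons] at this; tauto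
    have hgg : ¬ (g = (f :: g :: w).next x.1 (e x).1.2) := fun h =>
      hx (Subtype.ext_iff.mp (hnx (e x).1 h.symm))
    have hn : (f :: w).next x.1 x.2 = (f :: g :: w).next x.1 (e x).1.2 :=
      (List.nextOr_cons_cons_eq hw hxw).symm
    simp only [if_neg hx, cyclicMatrix, of_apply, eliminate, hn, F, G, nf, e, Equiv.coe_fn_mk,
      if_neg hyg] at hgg ⊢
    rw [if_neg hgg]
    ring

end CyclicDeterminant

/-! ### Removing passages that act as the identity. -/

section CyclicDeterminantMoves

variable {α R : Type*} [DecidableEq α] [CommRing R]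

theorem cyclicDet_cons_identity {T : α → α → R} {f : α} {w : List α} (hw : (f :: w).Nodup)
    (hf : T f f = 1) (h : ∀ y ∈ w, T f y = 0 ∧ T y f = 0) :
    cyclicDet T (f :: w) = cyclicDet T w := by
  -- With no other letter the matrix is the single entry `1 - 1`, which agrees with the value zero
  -- at the empty word. Otherwise the arc into `f` is eliminated by means of the predecessor `e` of
  -- `f`.
  rcases w.eq_nil_or_concat' with rfl | ⟨w, e, rfl⟩
  · have : Unique {x // x ∈ [f]} := ⟨⟨⟨f, by simp⟩⟩, fun x => Subtype.ext (by simpa using x.2)⟩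
    rw [cyclicDet_nil, cyclicDet, if_neg (by simp), Matrix.det_unique]
    have hd : (default : {x // x ∈ [f]}) = ⟨f, by simp⟩ := Subsingleton.elim _ _
    simp [cyclicMatrix, hd, hf]
  · have hr : f :: (w ++ [e]) ~r e :: f :: w :=
      (List.isRotated_append (l := f :: w) (l' := [e]))
    have hr' : e :: w ~r w ++ [e] := List.isRotated_append (l := [e]) (l' := w)
    have hn := hr.nodup_iff.mp hw
    have hef : T e f = 0 := (h e (by simp)).2
    rw [cyclicDet_isRotated T hw hr, cyclicDet_eliminate T hn 1 (by simp [hef]), hef, sub_zero,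
      one_mul, ← cyclicDet_isRotated T (by simp at hn ⊢; tauto) hr']
    refine cyclicDet_congr fun x hx y hy => ?_
    have hx' := h x (by simp at hx ⊢; tauto)
    have hy' := h y (by simp at hy ⊢; tauto)
    unfold eliminate
    split_ifs with hxe
    · simp [hy', hf, hxe]
    · simp [hx']

theorem cyclicDet_append_cons_identity {T : α → α → R} {f : α} {u v : List α}
    (hw : (u ++ f :: v).Nodup) (hf : T f f = 1) (h : ∀ y ∈ u ++ v, T f y = 0 ∧ T y f = 0) :
    cyclicDet T (u ++ f :: v) = cyclicDet T (u ++ v) := by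
  have hr : u ++ f :: v ~r f :: (v ++ u) := List.isRotated_append
  have hn := hr.nodup_iff.mp hw
  rw [cyclicDet_isRotated T hw hr, cyclicDet_cons_identity hn hf
    fun y hy => h y (by simp at hy ⊢; tauto)]
  exact cyclicDet_isRotated T (List.nodup_cons.mp hn).2 List.isRotated_append

theorem cyclicDet_append_eliminate (T : α → α → R) {f g : α} {u v : List α}
    (hw : (u ++ f :: g :: v).Nodup) (h : T f g = 0) :
    cyclicDet T (u ++ f :: g :: v) = cyclicDet (eliminate f g 1 T) (u ++ f :: v) := by
  have hr : u ++ f :: g :: v ~r f :: g :: (v ++ u) := List.isRotated_append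
  have hn := hr.nodup_iff.mp hw
  rw [cyclicDet_isRotated T hw hr,
    cyclicDet_eliminate T hn 1 (by simp [h]), h, sub_zero, one_mul]
  refine cyclicDet_isRotated _ ?_ (List.isRotated_append (l := f :: v) (l' := u))
  simp at hn ⊢; tauto

theorem cyclicDet_append_rename (T : α → α → R) {f g : α} {u v : List α}
    (hf : f ∉ u ++ v) (hg : g ∉ u ++ v) :
    cyclicDet T (u ++ f :: v)
      = cyclicDet (fun x y => T (Equiv.swap f g x) (Equiv.swap f g y)) (u ++ g :: v) := by
  rw [← cyclicDet_map (Equiv.swap f g).injective]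
  have key : ∀ l : List α, (∀ x ∈ l, x ∈ u ++ v) → l.map (Equiv.swap f g) = l := by
    intro l hl
    refine (List.map_congr_left fun x hx => ?_).trans (List.map_id l)
    exact Equiv.swap_apply_of_ne_of_ne (by rintro rfl; exact hf (hl _ hx))
      (by rintro rfl; exact hg (hl _ hx))
  rw [List.map_append, List.map_cons, Equiv.swap_apply_right, key u (by simp; tauto),
    key v (by simp; tauto)]

/-- A curl whose two passages act together as the identity can be removed. -/
theorem cyclicDet_curl (T : α → α → R) {x y : α} {w : List α} (hw : (x :: y :: w).Nodup) (u : R)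
    (hu : u * (1 - T x y) = 1) (h : T y x + T y y * u * T x x = 1)
    (h0 : ∀ a ∈ w, T x a = 0 ∧ T y a = 0 ∧ T a x = 0 ∧ T a y = 0) :
    cyclicDet T (x :: y :: w) = (1 - T x y) * cyclicDet T w := by
  have hn : (x :: w).Nodup := by simp at hw ⊢; tauto
  have hxw : ∀ a ∈ w, a ≠ x := by rintro a ha rfl; simp [ha] at hw
  rw [cyclicDet_eliminate T hw u hu, cyclicDet_cons_identity hn]
  · congr 1
    refine cyclicDet_congr fun a ha b hb => ?_
    simp [eliminate, hxw a ha, h0 a ha]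
  · simp [eliminate, h]
  · intro a ha
    simp [eliminate, hxw a ha, h0 a ha]

/-- Two pairs of passages that act together as the identity can be removed. -/
theorem cyclicDet_bigon (T : α → α → R) {c d x y : α} {u v : List α}
    (hw : (c :: d :: (u ++ x :: y :: v)).Nodup)
    (h0 : ∀ a ∈ u ++ v, ∀ b ∈ [c, d, x, y], T a b = 0 ∧ T b a = 0)
    (hcd : T c d = 0) (hxy : T x y + T x d * T c y = 0)
    (hcc : eliminate x y 1 (eliminate c d 1 T) c c = 1)
    (hcx : eliminate x y 1 (eliminate c d 1 T) c x = 0)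
    (hxc : eliminate x y 1 (eliminate c d 1 T) x c = 0)
    (hxx : eliminate x y 1 (eliminate c d 1 T) x x = 1) :
    cyclicDet T (c :: d :: (u ++ x :: y :: v)) = cyclicDet T (u ++ v) := by
  have hne : x ≠ c ∧ c ≠ x ∧ (∀ a ∈ u ++ v, a ≠ c ∧ a ≠ x) := by
    simp [List.nodup_append] at hw ⊢
    grind
  have h1 : (c :: (u ++ x :: y :: v)).Nodup := by simp [List.nodup_append] at hw ⊢; grind
  have h2 : (c :: (u ++ x :: v)).Nodup := by simp [List.nodup_append] at hw ⊢; grind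
  have h3 : (c :: (u ++ v)).Nodup := by simp [List.nodup_append] at hw ⊢; grind
  have hv : ∀ a ∈ u ++ v, (eliminate x y 1 (eliminate c d 1 T) c a = 0 ∧
      eliminate x y 1 (eliminate c d 1 T) a c = 0) ∧
      (eliminate x y 1 (eliminate c d 1 T) x a = 0 ∧
      eliminate x y 1 (eliminate c d 1 T) a x = 0) := by
    intro a ha
    have := h0 a ha
    simp only [List.mem_cons, List.not_mem_nil, or_false, forall_eq_or_imp, forall_eq] at this
    have hd := hne.2.2 a ha
    simp [eliminate, this, hne, hd]
  have e1 := cyclicDet_append_eliminate T (u := []) hw hcd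
  simp only [List.nil_append] at e1
  rw [e1, ← List.cons_append, cyclicDet_append_eliminate _ h1 (by simp [eliminate, hne, hxy]),
    cyclicDet_append_cons_identity h2 hxx, List.cons_append, cyclicDet_cons_identity h3 hcc]
  · refine cyclicDet_congr fun a ha b hb => ?_
    have := h0 a ha
    simp only [List.mem_cons, List.not_mem_nil, or_false, forall_eq_or_imp, forall_eq] at this
    simp [eliminate, hne.2.2 a ha, this]
  · exact fun a ha => (hv a ha).1
  · intro a ha
    rcases List.mem_cons.mp ha with rfl | ha
    · exact ⟨hxc, hcx⟩
    · exact (hv a ha).2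

end CyclicDeterminantMoves

/-! ### Crossing coefficients and the second Reidemeister move. -/

section Transfer

variable {R : Type*} [CommRing R]

/-- The coefficients of the equations at the crossings: every passage multiplies by `p`, and an
under-passage adds `k` times the arc that leads into the over-passage. -/
def transfer (p k : GaussLetter → R) (x y : GaussLetter) : R :=
  (if y = x then p x else 0) +
    if x.isOver = false ∧ y.isOver = true ∧ y.label = x.label then k x else 0

theorem transfer_eq_zero {p k : GaussLetter → R} {x y : GaussLetter} (h : x.label ≠ y.label) :
    transfer p k x y = 0 := by
  unfold transfer
  rw [if_neg (by rintro rfl; exact h rfl), if_neg (by rintro ⟨_, _, h'⟩; exact h h'.symm), add_zero]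

/-- Each strand crosses the bigon with factor one by `hp` and `hq`. By `hk` the two contributions of
the over-strand to the under-strand cancel when `c` is passed below before `d`. Multiplying `hk` by
the under-factor at `c` gives the cancellation for the other order. -/
theorem cyclicDet_transfer_reidemeister2 (p k : GaussLetter → R) {c d : ℕ} {ε : ℤˣ} (o : ℤˣ)
    {u v : List GaussLetter} (hcd : c ≠ d) (huv : (u ++ v).Nodup)
    (hl : ∀ x ∈ u ++ v, x.label ≠ c ∧ x.label ≠ d)
    (hp : p ⟨true, c, ε⟩ * p ⟨true, d, -ε⟩ = 1)
    (hq : p ⟨false, c, ε⟩ * p ⟨false, d, -ε⟩ = 1)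
    (hk : p ⟨false, d, -ε⟩ * k ⟨false, c, ε⟩ + k ⟨false, d, -ε⟩ * p ⟨true, c, ε⟩ = 0) :
    cyclicDet (transfer p k) ([⟨true, c, ε⟩, ⟨true, d, -ε⟩] ++ u ++
        orderedPair o ⟨false, c, ε⟩ ⟨false, d, -ε⟩ ++ v) =
      cyclicDet (transfer p k) (u ++ v) := by
  have hn : ∀ o c' ε', (c' = c ∨ c' = d) → (⟨o, c', ε'⟩ : GaussLetter) ∉ u ++ v :=
    fun o c' ε' h hx => by have := hl _ hx; simp only at this; tauto
  have hu : ∀ o c' ε', (c' = c ∨ c' = d) → (⟨o, c', ε'⟩ : GaussLetter) ∉ u :=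
    fun o c' ε' h hx => hn o c' ε' h (by simp [hx])
  have hv : ∀ o c' ε', (c' = c ∨ c' = d) → (⟨o, c', ε'⟩ : GaussLetter) ∉ v :=
    fun o c' ε' h hx => hn o c' ε' h (by simp [hx])
  simp only [List.nodup_append] at huv
  rcases Int.units_eq_one_or o with rfl | rfl
  · have hw : orderedPair 1 (⟨false, c, ε⟩ : GaussLetter) ⟨false, d, -ε⟩ =
        [⟨false, c, ε⟩, ⟨false, d, -ε⟩] :=
      if_pos rfl
    rw [hw]
    simp only [List.append_assoc, List.cons_append, List.nil_append]
    refine cyclicDet_bigon _ ?_ ?_ ?_ ?_ ?_ ?_ ?_ ?_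
    · simp [List.nodup_append, hcd, hu, hv, huv]
      grind
    · intro a ha b hb
      have := hl a ha
      constructor <;> apply transfer_eq_zero <;> simp at hb <;>
        rcases hb with rfl | rfl | rfl | rfl <;> simp [this, Ne.symm]
    all_goals simp [transfer, eliminate, hcd, hcd.symm]
    all_goals grind
  · have hw : orderedPair (-1) (⟨false, c, ε⟩ : GaussLetter) ⟨false, d, -ε⟩ =
        [⟨false, d, -ε⟩, ⟨false, c, ε⟩] :=
      if_neg (by decide)
    rw [hw]
    simp only [List.append_assoc, List.cons_append, List.nil_append]
    refine cyclicDet_bigon _ ?_ ?_ ?_ ?_ ?_ ?_ ?_ ?_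
    · simp [List.nodup_append, hcd, hcd.symm, hu, hv, huv]
      grind
    · intro a ha b hb
      have := hl a ha
      constructor <;> apply transfer_eq_zero <;> simp at hb <;>
        rcases hb with rfl | rfl | rfl | rfl <;> simp [this, Ne.symm]
    all_goals simp [transfer, eliminate, hcd, hcd.symm]
    all_goals grind

end Transfer

/-! ### Comparing the two sides of a triangle move. -/

section Triangle

variable {α R : Type*} [DecidableEq α] [CommRing R]

/-- The coefficients that remain when the arcs from `fᵢ` to `gᵢ` are eliminated one after the
other. -/
def eliminate₃ (f₁ g₁ f₂ g₂ f₃ g₃ : α) (T : α → α → R) : α → α → R :=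
  eliminate f₃ g₃ 1 (eliminate f₂ g₂ 1 (eliminate f₁ g₁ 1 T))

/-- The arcs from `fᵢ` to `gᵢ` can be eliminated one after the other. -/
def Eliminable₃ (f₁ g₁ f₂ g₂ f₃ g₃ : α) (T : α → α → R) : Prop :=
  T f₁ g₁ = 0 ∧ eliminate f₁ g₁ 1 T f₂ g₂ = 0 ∧
    eliminate f₂ g₂ 1 (eliminate f₁ g₁ 1 T) f₃ g₃ = 0

theorem cyclicDet_eliminate₃ {T : α → α → R} {f₁ g₁ f₂ g₂ f₃ g₃ : α}
    (h : Eliminable₃ f₁ g₁ f₂ g₂ f₃ g₃ T) {u v w : List α}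
    (hw : (f₁ :: g₁ :: (u ++ f₂ :: g₂ :: (v ++ f₃ :: g₃ :: w))).Nodup) :
    cyclicDet T (f₁ :: g₁ :: (u ++ f₂ :: g₂ :: (v ++ f₃ :: g₃ :: w))) =
      cyclicDet (eliminate₃ f₁ g₁ f₂ g₂ f₃ g₃ T) (f₁ :: (u ++ f₂ :: (v ++ f₃ :: w))) := by
  obtain ⟨h1, h2, h3⟩ := h
  have n2 : ((f₁ :: u) ++ f₂ :: g₂ :: (v ++ f₃ :: g₃ :: w)).Nodup :=
    hw.sublist (by simp)
  have n3 : ((f₁ :: (u ++ f₂ :: v)) ++ f₃ :: g₃ :: w).Nodup := by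
    refine n2.sublist ?_
    simp
  have e1 := cyclicDet_append_eliminate T (u := []) hw h1
  have e2 := cyclicDet_append_eliminate _ n2 h2
  have e3 := cyclicDet_append_eliminate _ n3 h3
  simp only [List.nil_append, List.cons_append, List.append_assoc] at e1 e2 e3
  rw [e1, e2, e3, eliminate₃]

theorem cyclicDet_eliminate₃' {T : α → α → R} {f₁ g₁ f₂ g₂ f₃ g₃ : α}
    (h : Eliminable₃ f₁ g₁ f₂ g₂ f₃ g₃ T) {u v w : List α}
    (hw : (f₁ :: g₁ :: (u ++ f₃ :: g₃ :: (v ++ f₂ :: g₂ :: w))).Nodup) :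
    cyclicDet T (f₁ :: g₁ :: (u ++ f₃ :: g₃ :: (v ++ f₂ :: g₂ :: w))) =
      cyclicDet (eliminate₃ f₁ g₁ f₂ g₂ f₃ g₃ T) (f₁ :: (u ++ f₃ :: (v ++ f₂ :: w))) := by
  obtain ⟨h1, h2, h3⟩ := h
  have n2 : ((f₁ :: (u ++ f₃ :: g₃ :: v)) ++ f₂ :: g₂ :: w).Nodup :=
    hw.sublist (by simp)
  have n3 : ((f₁ :: u) ++ f₃ :: g₃ :: (v ++ f₂ :: w)).Nodup := by
    refine n2.sublist ?_
    simp
  have e1 := cyclicDet_append_eliminate T (u := []) hw h1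
  have e2 := cyclicDet_append_eliminate _ n2 h2
  have e3 := cyclicDet_append_eliminate _ n3 h3
  simp only [List.nil_append, List.cons_append, List.append_assoc] at e1 e2 e3
  rw [e1, e2, e3, eliminate₃]

theorem cyclicDet_rename₃ (T : α → α → R) {f₁ g₁ f₂ g₂ f₃ g₃ : α} {u v w : List α}
    (hw : (f₁ :: g₁ :: (u ++ f₂ :: g₂ :: (v ++ f₃ :: g₃ :: w))).Nodup) :
    cyclicDet T (f₁ :: (u ++ f₂ :: (v ++ f₃ :: w))) =
      cyclicDet (fun x y =>
        T (Equiv.swap f₁ g₁ (Equiv.swap f₂ g₂ (Equiv.swap f₃ g₃ x)))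
          (Equiv.swap f₁ g₁ (Equiv.swap f₂ g₂ (Equiv.swap f₃ g₃ y))))
        (g₁ :: (u ++ g₂ :: (v ++ g₃ :: w))) := by
  simp only [List.nodup_append, List.nodup_cons, List.mem_append, List.mem_cons] at hw
  have e1 := cyclicDet_append_rename T (f := f₁) (g := g₁) (u := []) (v := u ++ f₂ :: (v ++ f₃ :: w))
    (by simp; grind) (by simp; grind)
  have e2 := cyclicDet_append_rename (fun x y => T (Equiv.swap f₁ g₁ x) (Equiv.swap f₁ g₁ y))
    (f := f₂) (g := g₂) (u := g₁ :: u) (v := v ++ f₃ :: w)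
    (by simp; grind) (by simp; grind)
  have e3 := cyclicDet_append_rename (fun x y => T (Equiv.swap f₁ g₁ (Equiv.swap f₂ g₂ x))
      (Equiv.swap f₁ g₁ (Equiv.swap f₂ g₂ y)))
    (f := f₃) (g := g₃) (u := g₁ :: (u ++ g₂ :: v)) (v := w)
    (by simp; grind) (by simp; grind)
  simp only [List.nil_append, List.cons_append, List.append_assoc] at e1 e2 e3
  rw [e1, e2, e3]

/-- Eliminating the inner arc of each strand leaves one letter per strand, `fᵢ` before the move and
`gᵢ` after it. Once renamed, the two systems have the same coefficients by `key`. The eliminations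
run in the same order whichever way the strands are joined, so one `key` serves both cyclic orders.
-/
theorem cyclicDet_triangle {T : α → α → R} {f₁ g₁ f₂ g₂ f₃ g₃ : α}
    (h : Eliminable₃ f₁ g₁ f₂ g₂ f₃ g₃ T) (h' : Eliminable₃ g₁ f₁ g₂ f₂ g₃ f₃ T)
    {u v w : List α} (S : α → Prop) (hS : ∀ x ∈ u ++ v ++ w, S x)
    (key : ∀ x y, (x = g₁ ∨ x = g₂ ∨ x = g₃ ∨ S x) → (y = g₁ ∨ y = g₂ ∨ y = g₃ ∨ S y) →
      eliminate₃ f₁ g₁ f₂ g₂ f₃ g₃ T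
        (Equiv.swap f₁ g₁ (Equiv.swap f₂ g₂ (Equiv.swap f₃ g₃ x)))
        (Equiv.swap f₁ g₁ (Equiv.swap f₂ g₂ (Equiv.swap f₃ g₃ y))) =
      eliminate₃ g₁ f₁ g₂ f₂ g₃ f₃ T x y) :
    ((f₁ :: g₁ :: (u ++ f₂ :: g₂ :: (v ++ f₃ :: g₃ :: w))).Nodup →
      cyclicDet T (f₁ :: g₁ :: (u ++ f₂ :: g₂ :: (v ++ f₃ :: g₃ :: w))) =
      cyclicDet T (g₁ :: f₁ :: (u ++ g₂ :: f₂ :: (v ++ g₃ :: f₃ :: w)))) ∧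
    ((f₁ :: g₁ :: (u ++ f₃ :: g₃ :: (v ++ f₂ :: g₂ :: w))).Nodup →
      cyclicDet T (f₁ :: g₁ :: (u ++ f₃ :: g₃ :: (v ++ f₂ :: g₂ :: w))) =
      cyclicDet T (g₁ :: f₁ :: (u ++ g₃ :: f₃ :: (v ++ g₂ :: f₂ :: w)))) := by
  have hS' : ∀ x, (x ∈ u ∨ x ∈ v ∨ x ∈ w) → S x := fun x hx => hS x (by simp; tauto)
  constructor <;> intro hw
  · have hn : (g₁ :: f₁ :: (u ++ g₂ :: f₂ :: (v ++ g₃ :: f₃ :: w))).Nodup := by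
      refine List.Perm.nodup ?_ hw
      refine (List.Perm.swap ..).trans (.cons _ (.cons _ (.append_left _ ?_)))
      refine (List.Perm.swap ..).trans (.cons _ (.cons _ (.append_left _ (.swap ..))))
    rw [cyclicDet_eliminate₃ h hw, cyclicDet_eliminate₃ h' hn, cyclicDet_rename₃ _ hw]
    refine cyclicDet_congr fun x hx y hy => key x y ?_ ?_
    · have := hS' x; simp at hx; tauto
    · have := hS' y; simp at hy; tauto
  · have hn : (g₁ :: f₁ :: (u ++ g₃ :: f₃ :: (v ++ g₂ :: f₂ :: w))).Nodup := by
      refine List.Perm.nodup ?_ hw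
      refine (List.Perm.swap ..).trans (.cons _ (.cons _ (.append_left _ ?_)))
      refine (List.Perm.swap ..).trans (.cons _ (.cons _ (.append_left _ (.swap ..))))
    -- The transpositions are disjoint, hence commute.
    have hc : ∀ x, Equiv.swap f₁ g₁ (Equiv.swap f₃ g₃ (Equiv.swap f₂ g₂ x)) =
        Equiv.swap f₁ g₁ (Equiv.swap f₂ g₂ (Equiv.swap f₃ g₃ x)) := by
      intro x
      congr 1
      simp only [List.nodup_append, List.nodup_cons, List.mem_append, List.mem_cons] at hw
      simp only [Equiv.swap_apply_def]
      grind
    rw [cyclicDet_eliminate₃' h hw, cyclicDet_eliminate₃' h' hn, cyclicDet_rename₃ _ hw]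
    refine cyclicDet_congr fun x hx y hy => ?_
    simp only [hc]
    refine key x y ?_ ?_
    · have := hS' x; simp at hx; tauto
    · have := hS' y; simp at hy; tauto

end Triangle

/-! ### The third Reidemeister move for general coefficients. -/

section TransferReidemeister3

variable {R : Type*} [CommRing R]

theorem orderedPair_one (x y : GaussLetter) : orderedPair 1 x y = [x, y] := if_pos rfl

theorem orderedPair_neg_one (x y : GaussLetter) : orderedPair (-1) x y = [y, x] :=
  if_neg (by decide)

-- The hypotheses compare what enters the triangle with what leaves it, before and after the move.
-- `h₁` is the effect of the top strand on the middle one, and `h₂` that of the middle strand on the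
-- bottom one. `h₃` is the effect of the top strand on the bottom one, both directly at `b` and
-- through the middle strand. The factor of each strand on itself agrees by commutativity.
set_option maxHeartbeats 4000000 in
theorem cyclicDet_transfer_reidemeister3 (p k : GaussLetter → R) {a b c : ℕ} (α β γ o₁ o₂ o₃ : ℤˣ)
    {u v w : List GaussLetter} (hab : a ≠ b) (hac : a ≠ c) (hbc : b ≠ c)
    (hl : ∀ x ∈ u ++ v ++ w, x.label ≠ a ∧ x.label ≠ b ∧ x.label ≠ c)
    (h₁ : k ⟨false, a, α⟩ * p ⟨true, c, γ⟩ * (if o₁ = o₂ then 1 else p ⟨true, b, β⟩) =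
      k ⟨false, a, α⟩ * (if o₁ = o₂ then p ⟨true, b, β⟩ else 1))
    (h₂ : k ⟨false, c, γ⟩ * (if o₂ = o₃ then p ⟨false, a, α⟩ else 1) =
      p ⟨false, b, β⟩ * k ⟨false, c, γ⟩ * (if o₂ = o₃ then 1 else p ⟨false, a, α⟩))
    (h₃ : (if o₂ = o₃ then
        p ⟨false, c, γ⟩ * k ⟨false, b, β⟩ * (if o₁ = o₃ then p ⟨true, a, α⟩ else 1) +
          k ⟨false, c, γ⟩ * k ⟨false, a, α⟩ * (if o₁ = o₂ then 1 else p ⟨true, b, β⟩)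
      else
        p ⟨false, c, γ⟩ * k ⟨false, b, β⟩ * (if o₁ = o₃ then p ⟨true, a, α⟩ else 1)) =
      (if o₂ = o₃ then
        k ⟨false, b, β⟩ * (if o₁ = o₃ then 1 else p ⟨true, a, α⟩)
      else
        p ⟨false, b, β⟩ * k ⟨false, c, γ⟩ * k ⟨false, a, α⟩ *
          (if o₁ = o₂ then 1 else p ⟨true, b, β⟩) +
        k ⟨false, b, β⟩ * (if o₁ = o₃ then 1 else p ⟨true, a, α⟩))) :
    let top := fun o => orderedPair o (⟨true, a, α⟩ : GaussLetter) ⟨true, b, β⟩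
    let mid := fun o => orderedPair o (⟨false, a, α⟩ : GaussLetter) ⟨true, c, γ⟩
    let bot := fun o => orderedPair o (⟨false, b, β⟩ : GaussLetter) ⟨false, c, γ⟩
    ((top o₁ ++ u ++ mid o₂ ++ v ++ bot o₃ ++ w).Nodup →
      cyclicDet (transfer p k) (top o₁ ++ u ++ mid o₂ ++ v ++ bot o₃ ++ w) =
      cyclicDet (transfer p k) (top (-o₁) ++ u ++ mid (-o₂) ++ v ++ bot (-o₃) ++ w)) ∧
    ((top o₁ ++ u ++ bot o₃ ++ v ++ mid o₂ ++ w).Nodup →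
      cyclicDet (transfer p k) (top o₁ ++ u ++ bot o₃ ++ v ++ mid o₂ ++ w) =
      cyclicDet (transfer p k) (top (-o₁) ++ u ++ bot (-o₃) ++ v ++ mid (-o₂) ++ w)) := by
  have hba := hab.symm
  have hca := hac.symm
  have hcb := hbc.symm
  have d1 : (1 : ℤˣ) ≠ -1 := by decide
  have d2 : (-1 : ℤˣ) ≠ 1 := by decide
  rcases Int.units_eq_one_or o₁ with rfl | rfl <;> rcases Int.units_eq_one_or o₂ with rfl | rfl <;>
    rcases Int.units_eq_one_or o₃ with rfl | rfl <;>
    simp only [orderedPair_one, orderedPair_neg_one, neg_neg, List.append_assoc, List.cons_append,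
      List.nil_append] <;>
    simp only [if_true, if_neg d1, if_neg d2, mul_one] at h₁ h₂ h₃ <;>
    refine cyclicDet_triangle ?_ ?_
      (fun x : GaussLetter => x.label ≠ a ∧ x.label ≠ b ∧ x.label ≠ c) hl ?_
  all_goals first
    | (simp [Eliminable₃, eliminate, transfer, hab, hac, hbc, hba, hca, hcb]; done)
    | rintro x y (rfl | rfl | rfl | hx) (rfl | rfl | rfl | hy)
  all_goals try obtain ⟨hx₁, hx₂, hx₃⟩ := hx
  all_goals try obtain ⟨hy₁, hy₂, hy₃⟩ := hy
  all_goals try have hx₁' := hx₁.symm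
  all_goals try have hx₂' := hx₂.symm
  all_goals try have hx₃' := hx₃.symm
  all_goals try obtain ⟨ox, lx, sx⟩ := x
  all_goals try obtain ⟨oy, ly, sy⟩ := y
  all_goals try dsimp only at *
  all_goals clear hl
  all_goals first
    | simp [eliminate₃, eliminate, transfer, Equiv.swap_apply_def, hab, hac, hbc, hba, hca,
      hcb, hx₁, hx₂, hx₃, hx₁', hx₂', hx₃', hy₁, hy₂, hy₃]
    | simp [eliminate₃, eliminate, transfer, Equiv.swap_apply_def, hab, hac, hbc, hba, hca,
      hcb, hx₁, hx₂, hx₃, hx₁', hx₂', hx₃']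
    | simp [eliminate₃, eliminate, transfer, Equiv.swap_apply_def, hab, hac, hbc, hba, hca,
      hcb, hy₁, hy₂, hy₃]
    | simp [eliminate₃, eliminate, transfer, Equiv.swap_apply_def, hab, hac, hbc, hba, hca,
      hcb]
  all_goals try grind

end TransferReidemeister3

/-! ### Parity of crossings through sums of positions. -/

section Parity

/-- The sum modulo two of the positions of the letters with label `c`. -/
def positionSum (c : ℕ) : List GaussLetter → ZMod 2
  | [] => 0
  | _ :: w => positionSum c w + (w.map GaussLetter.label).count c

theorem positionSum_append (c : ℕ) (u v : List GaussLetter) :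
    positionSum c (u ++ v) =
      positionSum c u + positionSum c v + u.length * (v.map GaussLetter.label).count c := by
  induction u with
  | nil => simp [positionSum]
  | cons x u ih =>
    simp only [List.cons_append, positionSum, ih, List.map_append, List.count_append,
      List.length_cons]
    push_cast
    ring

theorem positionSum_eq_sum (c : ℕ) (w : List GaussLetter) :
    positionSum c w = ∑ i : Fin w.length, if (w.get i).label = c then ((i : ℕ) : ZMod 2) else 0 := by
  induction w with
  | nil => rfl
  | cons x w ih =>
    have hc : (((w.map GaussLetter.label).count c : ℕ) : ZMod 2) =
        ∑ i : Fin w.length, if (w.get i).label = c then (1 : ZMod 2) else 0 := by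
      clear ih
      induction w with
      | nil => rfl
      | cons y w ih =>
        rw [List.map_cons, List.count_cons]
        simp only [List.length_cons, Fin.sum_univ_succ]
        push_cast
        rw [ih]
        simp only [add_comm, beq_iff_eq]
        congr
    rw [positionSum, ih, hc, ← Finset.sum_add_distrib]
    simp only [List.length_cons, Fin.sum_univ_succ]
    simp only [Fin.val_zero, Nat.cast_zero, ite_self, zero_add, Fin.val_succ]
    refine Finset.sum_congr rfl fun i _ => ?_
    change (if (w.get i).label = c then _ else _) + (if (w.get i).label = c then _ else _) =
      if (w.get i).label = c then _ else _
    split_ifs <;> simp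

theorem count_label_eq_card (c : ℕ) (w : List GaussLetter) :
    (w.map GaussLetter.label).count c =
      (Finset.univ.filter fun i : Fin w.length => (w.get i).label = c).card := by
  rw [Finset.card_filter]
  induction w with
  | nil => rfl
  | cons y w ih =>
    rw [List.map_cons, List.count_cons]
    simp only [List.length_cons, Fin.sum_univ_succ]
    rw [ih]
    simp only [add_comm, beq_iff_eq]
    congr

/-- For positions `i < j`, the number `j - i - 1` is odd exactly when `i + j` is even. -/
theorem isOddCrossing_iff {w : List GaussLetter} {c : ℕ}
    (h : (w.map GaussLetter.label).count c = 2) : IsOddCrossing w c ↔ positionSum c w = 0 := by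
  rw [count_label_eq_card, Finset.card_eq_two] at h
  obtain ⟨i, j, hij, h⟩ := h
  have hmem : ∀ m, (w.get m).label = c ↔ m = i ∨ m = j := by
    intro m
    have := Finset.ext_iff.mp h m
    simpa using this
  rw [positionSum_eq_sum, ← Finset.sum_filter, h, Finset.sum_pair hij, ← Nat.cast_add,
    ZMod.natCast_eq_zero_iff_even]
  have hne : (i : ℕ) ≠ j := fun h => hij (Fin.ext h)
  constructor
  · rintro ⟨p, q, hpq, hp, hq, hodd⟩
    rw [hmem] at hp hq
    have hpq' : (p : ℕ) < q := hpq
    rw [Nat.even_iff]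
    rw [Nat.odd_iff] at hodd
    rcases hp with rfl | rfl <;> rcases hq with rfl | rfl <;> omega
  · intro he
    rw [Nat.even_iff] at he
    rcases lt_or_gt_of_ne hij with hlt | hlt
    · have : (i : ℕ) < j := hlt
      exact ⟨i, j, hlt, (hmem i).2 (.inl rfl), (hmem j).2 (.inr rfl), by rw [Nat.odd_iff]; omega⟩
    · have : (j : ℕ) < i := hlt
      exact ⟨j, i, hlt, (hmem j).2 (.inr rfl), (hmem i).2 (.inl rfl), by rw [Nat.odd_iff]; omega⟩

theorem sum_count_label_eq_length (w : List GaussLetter) {S : Finset ℕ}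
    (hS : ∀ x ∈ w, x.label ∈ S) : ∑ c ∈ S, (w.map GaussLetter.label).count c = w.length := by
  induction w with
  | nil => simp
  | cons x w ih =>
    simp only [List.map_cons, List.count_cons, Finset.sum_add_distrib, List.length_cons]
    rw [ih fun y hy => hS y (by simp [hy])]
    simp [hS x (by simp)]

theorem sum_positionSum (w : List GaussLetter) {S : Finset ℕ} (hS : ∀ x ∈ w, x.label ∈ S) :
    ∑ c ∈ S, positionSum c w = ((∑ i ∈ Finset.range w.length, i : ℕ) : ZMod 2) := by
  induction w with
  | nil => simp [positionSum]
  | cons x w ih =>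
    have hS' : ∀ y ∈ w, y.label ∈ S := fun y hy => hS y (by simp [hy])
    simp only [positionSum, Finset.sum_add_distrib, List.length_cons, Finset.sum_range_succ]
    rw [ih hS', ← Nat.cast_sum, sum_count_label_eq_length w hS', Nat.cast_add]

namespace GaussCode

variable (D : GaussCode)

theorem count_label (c : ℕ) :
    (D.word.map GaussLetter.label).count c = 0 ∨ (D.word.map GaussLetter.label).count c = 2 := by
  have h : (D.word.map GaussLetter.label).count c =
      (D.word.filter fun x => x.label = c).length := by
    rw [List.count, List.countP_map, List.countP_eq_length_filter]
    congr 2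
  rw [h]
  rcases D.valid c with h | ⟨ε, h⟩
  · simp [h]
  · right; simpa using h.length_eq

theorem count_label_eq_two {x : GaussLetter} (hx : x ∈ D.word) :
    (D.word.map GaussLetter.label).count x.label = 2 := by
  refine (D.count_label x.label).resolve_left fun h => ?_
  exact List.count_eq_zero.mp h (List.mem_map_of_mem hx)

theorem sign_eq_of_label_eq {x y : GaussLetter} (hx : x ∈ D.word) (hy : y ∈ D.word)
    (h : x.label = y.label) : x.sign = y.sign := by
  have hx' : x ∈ D.word.filter fun z => z.label = x.label := by simp [hx]
  have hy' : y ∈ D.word.filter fun z => z.label = x.label := by simp [hy, h]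
  rcases D.valid x.label with h | ⟨ε, h⟩
  · simp [h] at hx'
  · rw [h.mem_iff] at hx' hy'
    simp only [List.mem_cons, List.not_mem_nil, or_false] at hx' hy'
    rcases hx' with h1 | h1 <;> rcases hy' with h2 | h2 <;> rw [h1, h2]

theorem nodup : D.word.Nodup := by
  rw [List.nodup_iff_count_le_one]
  intro x
  have h1 : D.word.count x = (D.word.filter fun z => z.label = x.label).count x :=
    (List.count_filter (by simp)).symm
  rw [h1]
  rcases D.valid x.label with h | ⟨ε, h⟩
  · simp [h]
  · rw [h.count_eq]
    exact List.nodup_iff_count_le_one.mp (by simp) x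

theorem even_length : Even D.word.length := by
  rw [← sum_count_label_eq_length D.word (S := (D.word.map GaussLetter.label).toFinset)
    (by intro x hx; simp only [List.mem_toFinset]; exact List.mem_map_of_mem hx)]
  refine Finset.even_sum _ fun c _ => ?_
  rcases D.count_label c with h | h <;> simp [h]

/-- With `n` crossings the positions `0, …, 2n - 1` add up to `n(2n - 1)`, which is congruent to `n`
modulo two. Grouped by crossing, the same sum counts the even crossings. So the number of even
crossings is congruent to `n`, and the number of odd ones is even. -/
theorem even_numOdd : Even D.numOdd := by
  set S := (D.word.map GaussLetter.label).toFinset with hS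
  have hmem : ∀ x ∈ D.word, x.label ∈ S := by
    intro x hx; simp only [hS, List.mem_toFinset]; exact List.mem_map_of_mem hx
  have hcount : ∀ c ∈ S, (D.word.map GaussLetter.label).count c = 2 := by
    intro c hc
    simp only [hS, List.mem_toFinset, List.mem_map] at hc
    obtain ⟨x, hx, rfl⟩ := hc
    exact D.count_label_eq_two hx
  have h1 : D.word.length = S.card * 2 := by
    rw [← sum_count_label_eq_length D.word hmem, Finset.sum_const_nat hcount]
  have h2 := sum_positionSum D.word hmem
  have h3 : ∑ c ∈ S, positionSum c D.word =
      ((S.filter fun c => ¬ IsOddCrossing D.word c).card : ZMod 2) := by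
    rw [Finset.card_filter, Nat.cast_sum]
    refine Finset.sum_congr rfl fun c hc => ?_
    have h := isOddCrossing_iff (hcount c hc)
    have : ∀ a : ZMod 2, a = if a = 0 then 0 else 1 := by decide
    rw [this (positionSum c D.word)]
    simp only [h]
    split_ifs <;> simp
  have h4 : ∑ i ∈ Finset.range (S.card * 2), i + S.card * 1 = 2 * (S.card * S.card) := by
    have := Finset.sum_range_id_mul_two (S.card * 2)
    rcases Nat.eq_zero_or_pos S.card with h | h
    · simp [h]
    · obtain ⟨m, hm⟩ : ∃ m, S.card * 2 = m + 1 := ⟨S.card * 2 - 1, by omega⟩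
      rw [hm, Nat.add_sub_cancel] at this
      rw [hm]
      nlinarith
  rw [h1, h3, ZMod.natCast_eq_natCast_iff'] at h2
  have h5 := Finset.card_filter_add_card_filter_not (s := S) fun c => IsOddCrossing D.word c
  rw [numOdd, ← hS, Nat.even_iff]
  omega

end GaussCode

end Parity

/-! ### Relabelling, base point, and the first two Reidemeister moves. -/

section Invariance

variable {R : Type*} [CommRing R] (s t z : Rˣ)

/-- The factor by which the passage `x` multiplies, where `P` holds at the odd crossings. -/
def weight (P : ℕ → Prop) [DecidablePred P] (x : GaussLetter) : R :=
  if P x.label then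
    if x.isOver then ((z ^ (x.sign : ℤ) : Rˣ) : R) else ((z ^ (-(x.sign : ℤ)) : Rˣ) : R)
  else
    if x.isOver then ((s ^ (x.sign : ℤ) : Rˣ) : R) else ((t ^ (x.sign : ℤ) : Rˣ) : R)

/-- The coefficient of the over-arc in the equation of the under-passage `x`, where `P` holds at
the odd crossings. -/
def shear (P : ℕ → Prop) [DecidablePred P] (x : GaussLetter) : R :=
  if P x.label then 0 else 1 - ((s ^ (x.sign : ℤ) * t ^ (x.sign : ℤ) : Rˣ) : R)

/-- The determinant of the matrix of relations, with the value zero at the empty word. -/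
def relationDet (w : List GaussLetter) : R :=
  if w = [] then 0 else (relationMatrix s t z w).det

/-- This separates the two roles of the word: once the parity predicate is a parameter of the
coefficients, the word can change while they stay fixed. -/
theorem relationDet_eq (w : List GaussLetter) :
    relationDet s t z w = cyclicDet (transfer (weight s t z (IsOddCrossing w))
      (shear s t (IsOddCrossing w))) w := by
  unfold relationDet cyclicDet
  congr 2
  ext ⟨⟨o, l, ε⟩, hx⟩ y
  cases o <;> simp [relationMatrix, cyclicMatrix, transfer, weight, shear, Subtype.ext_iff] <;>
    split_ifs <;> simp_all

theorem cyclicDet_transfer_congr {P Q : ℕ → Prop} [DecidablePred P] [DecidablePred Q]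
    {w : List GaussLetter} (h : ∀ x ∈ w, P x.label ↔ Q x.label) :
    cyclicDet (transfer (weight s t z P) (shear s t P)) w =
      cyclicDet (transfer (weight s t z Q) (shear s t Q)) w := by
  refine cyclicDet_congr fun x hx y _ => ?_
  simp only [transfer, weight, shear, h x hx]

theorem isOddCrossing_congr {D D' : GaussCode} {c c' : ℕ}
    (hc : (D.word.map GaussLetter.label).count c = 2)
    (hc' : (D'.word.map GaussLetter.label).count c' = 2)
    (h : positionSum c D.word = positionSum c' D'.word) :
    IsOddCrossing D.word c ↔ IsOddCrossing D'.word c' := by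
  rw [isOddCrossing_iff hc, isOddCrossing_iff hc', h]

theorem relationDet_relabel (D D' : GaussCode) (φ : Equiv.Perm ℕ)
    (h : D'.word = D.word.map fun x => ⟨x.isOver, φ x.label, x.sign⟩) :
    relationDet s t z D'.word = relationDet s t z D.word := by
  have hinj : Function.Injective fun x : GaussLetter =>
      (⟨x.isOver, φ x.label, x.sign⟩ : GaussLetter) := by
    rintro ⟨o, l, ε⟩ ⟨o', l', ε'⟩ h
    simpa using h
  have hcount : ∀ c (w : List GaussLetter), ((w.map fun x : GaussLetter =>
      (⟨x.isOver, φ x.label, x.sign⟩ : GaussLetter)).map GaussLetter.label).count (φ c) =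
      (w.map GaussLetter.label).count c := by
    intro c w
    rw [← List.count_map_of_injective (w.map GaussLetter.label) φ φ.injective, List.map_map, List.map_map]
    rfl
  have hsum : ∀ c (w : List GaussLetter), positionSum (φ c) (w.map fun x : GaussLetter =>
      (⟨x.isOver, φ x.label, x.sign⟩ : GaussLetter)) = positionSum c w := by
    intro c w
    induction w with
    | nil => rfl
    | cons x w ih => rw [List.map_cons, positionSum, positionSum, ih, hcount]
  rw [relationDet_eq, relationDet_eq]
  conv_lhs => rw [h, cyclicDet_map hinj]
  refine cyclicDet_congr fun x hx y _ => ?_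
  have hP : IsOddCrossing (D.word.map fun x : GaussLetter =>
      (⟨x.isOver, φ x.label, x.sign⟩ : GaussLetter)) (φ x.label) ↔
      IsOddCrossing D.word x.label := by
    have h2 := D.count_label_eq_two hx
    rw [isOddCrossing_iff h2, isOddCrossing_iff (by rw [hcount, h2]), hsum]
  obtain ⟨o, l, ε⟩ := x
  obtain ⟨o', l', ε'⟩ := y
  simp only [transfer, weight, shear, hP, GaussLetter.mk.injEq, φ.injective.eq_iff]

/-- Rotation preserves parity because the word has even length and each label occurs twice: `u` and
`v` agree modulo two in length and in the count of each label. -/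
theorem relationDet_rotate (D D' : GaussCode) (u v : List GaussLetter)
    (h : D.word = u ++ v) (h' : D'.word = v ++ u) :
    relationDet s t z D'.word = relationDet s t z D.word := by
  have hr : D.word ~r D'.word := by rw [h, h']; exact List.isRotated_append
  rw [relationDet_eq, relationDet_eq, ← cyclicDet_isRotated _ D.nodup hr]
  refine cyclicDet_transfer_congr s t z fun x hx => ?_
  have h2 := D.count_label_eq_two hx
  have h2' := D'.count_label_eq_two (hr.mem_iff.mp hx)
  refine isOddCrossing_congr h2' h2 ?_
  have hl := D.even_length
  rw [h, List.map_append, List.count_append] at h2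
  rw [h, List.length_append] at hl
  rw [h, h', positionSum_append, positionSum_append]
  have e1 : ((u.length : ℕ) : ZMod 2) = v.length := by
    rw [ZMod.natCast_eq_natCast_iff']
    rw [Nat.even_iff] at hl; omega
  have e2 : (((u.map GaussLetter.label).count x.label : ℕ) : ZMod 2) =
      (v.map GaussLetter.label).count x.label := by
    rw [ZMod.natCast_eq_natCast_iff']; omega
  rw [e1, e2]; ring

theorem positionSum_eq_zero {c : ℕ} {w : List GaussLetter}
    (hw : (w.map GaussLetter.label).count c = 0) : positionSum c w = 0 := by
  induction w with
  | nil => rfl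
  | cons x w ih =>
    rw [List.map_cons, List.count_cons] at hw
    rw [positionSum, ih (by omega), Nat.eq_zero_of_add_eq_zero_right hw, Nat.cast_zero, add_zero]

/-- The curl occupies positions 0 and 1, so it is even, and all other positions shift by two. Its
two passages together act as the identity, since `(1 - s ^ ε * t ^ ε) + s ^ ε * t ^ ε = 1`. -/
theorem relationDet_reidemeister1 (D D' : GaussCode) (o : Bool) (c : ℕ) (ε : ℤˣ)
    (h : D'.word = [⟨o, c, ε⟩, ⟨!o, c, ε⟩] ++ D.word) :
    ∃ a b : ℤ, relationDet s t z D'.word =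
      ((s ^ a * t ^ b : Rˣ) : R) * relationDet s t z D.word := by
  have hc2 : (D'.word.map GaussLetter.label).count c = 2 :=
    D'.count_label_eq_two (x := ⟨o, c, ε⟩) (by simp [h])
  have hc0 : ∀ a ∈ D.word, a.label ≠ c := by
    rintro a ha rfl
    have : (D.word.map GaussLetter.label).count a.label = 0 := by simpa [h] using hc2
    exact List.count_eq_zero.mp this (List.mem_map_of_mem ha)
  have hcount : (D.word.map GaussLetter.label).count c = 0 := by simpa [h] using hc2
  have hP : ¬ IsOddCrossing D'.word c := by
    rw [isOddCrossing_iff hc2, h, positionSum_append, hcount, positionSum_eq_zero hcount]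
    simp [positionSum]
  have hQ : ∀ x ∈ D.word, IsOddCrossing D'.word x.label ↔ IsOddCrossing D.word x.label := by
    intro x hx
    refine isOddCrossing_congr (D'.count_label_eq_two (by simp [h, hx]))
      (D.count_label_eq_two hx) ?_
    have := (hc0 x hx).symm
    rw [h, positionSum_append]
    simp [positionSum, this, show (2 : ZMod 2) = 0 from rfl]
  have hn := D'.nodup
  rw [relationDet_eq s t z D.word, ← cyclicDet_transfer_congr s t z hQ, relationDet_eq]
  set T := transfer (weight s t z (IsOddCrossing D'.word)) (shear s t (IsOddCrossing D'.word)) with hT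
  have h0 : ∀ a ∈ D.word, T ⟨o, c, ε⟩ a = 0 ∧ T ⟨!o, c, ε⟩ a = 0 ∧ T a ⟨o, c, ε⟩ = 0 ∧
      T a ⟨!o, c, ε⟩ = 0 := by
    intro a ha
    refine ⟨?_, ?_, ?_, ?_⟩ <;> apply transfer_eq_zero <;> simp [hc0 a ha, (hc0 a ha).symm]
  rw [h, List.cons_append, List.cons_append, List.nil_append] at hn ⊢
  cases o with
  | true =>
    refine ⟨0, 0, ?_⟩
    rw [cyclicDet_curl T hn 1 _ _ h0]
    · simp [hT, transfer]
    · simp [hT, transfer]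
    · simp [hT, transfer, weight, shear, hP]; ring
  | false =>
    -- When the under-passage comes first, the eliminated arc is the over-arc in its own equation.
    -- The pivot `1 - (1 - s ^ ε * t ^ ε)` is the only source of a nontrivial factor.
    refine ⟨ε, ε, ?_⟩
    have hxy : 1 - T ⟨false, c, ε⟩ ⟨!false, c, ε⟩ =
        ((s ^ (ε : ℤ) * t ^ (ε : ℤ) : Rˣ) : R) := by
      simp [hT, transfer, shear, hP]
    rw [cyclicDet_curl T hn (((s ^ (ε : ℤ) * t ^ (ε : ℤ))⁻¹ : Rˣ) : R) _ _ h0, hxy]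
    · rw [hxy, Units.inv_mul]
    · have e1 : T ⟨!false, c, ε⟩ ⟨false, c, ε⟩ = 0 := by simp [hT, transfer]
      have e2 : T ⟨!false, c, ε⟩ ⟨!false, c, ε⟩ = ((s ^ (ε : ℤ) : Rˣ) : R) := by
        simp [hT, transfer, weight, hP]
      have e3 : T ⟨false, c, ε⟩ ⟨false, c, ε⟩ = ((t ^ (ε : ℤ) : Rˣ) : R) := by
        simp [hT, transfer, weight, hP]
      rw [e1, e2, e3, zero_add, ← Units.val_mul, ← Units.val_mul, mul_right_comm, mul_inv_cancel,
        Units.val_one]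

theorem length_orderedPair (o : ℤˣ) (x y : GaussLetter) : (orderedPair o x y).length = 2 := by
  unfold orderedPair; split_ifs <;> rfl

theorem count_label_orderedPair (c : ℕ) (o : ℤˣ) (x y : GaussLetter) :
    ((orderedPair o x y).map GaussLetter.label).count c =
      (if x.label = c then 1 else 0) + if y.label = c then 1 else 0 := by
  unfold orderedPair; split_ifs <;> simp_all

theorem positionSum_orderedPair (c : ℕ) (o : ℤˣ) (x y : GaussLetter) :
    positionSum c (orderedPair o x y) =
      if (if o = 1 then y else x).label = c then 1 else 0 := by
  unfold orderedPair; split_ifs <;> simp_all [positionSum]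

theorem relationDet_reidemeister2 (D D' : GaussCode) (c d : ℕ) (ε o : ℤˣ)
    (u v : List GaussLetter) (h : D.word = u ++ v)
    (h' : D'.word = [⟨true, c, ε⟩, ⟨true, d, -ε⟩] ++ u ++
        orderedPair o ⟨false, c, ε⟩ ⟨false, d, -ε⟩ ++ v) :
    relationDet s t z D'.word = relationDet s t z D.word := by
  have hc := D'.count_label_eq_two (x := ⟨true, c, ε⟩) (by simp [h'])
  have hd := D'.count_label_eq_two (x := ⟨true, d, -ε⟩) (by simp [h'])
  -- The move itself does not require new labels. That `c` and `d` are distinct and absent from `u`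
  -- and `v` follows from the validity of `D'`.
  have hcd : c ≠ d := by
    rintro rfl
    simp [h', count_label_orderedPair] at hc
  have hdc := hcd.symm
  have hc0 : (u.map GaussLetter.label).count c = 0 ∧ (v.map GaussLetter.label).count c = 0 := by
    simp only [h', List.map_append, List.count_append, count_label_orderedPair] at hc
    simp [hcd, hdc] at hc
    omega
  have hd0 : (u.map GaussLetter.label).count d = 0 ∧ (v.map GaussLetter.label).count d = 0 := by
    simp only [h', List.map_append, List.count_append, count_label_orderedPair] at hd
    simp [hcd, hdc] at hd
    omega
  have hl : ∀ x ∈ u ++ v, x.label ≠ c ∧ x.label ≠ d := by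
    intro x hx
    refine ⟨?_, ?_⟩ <;> rintro rfl
    · rcases List.mem_append.mp hx with hx | hx
      · exact List.count_eq_zero.mp hc0.1 (List.mem_map_of_mem hx)
      · exact List.count_eq_zero.mp hc0.2 (List.mem_map_of_mem hx)
    · rcases List.mem_append.mp hx with hx | hx
      · exact List.count_eq_zero.mp hd0.1 (List.mem_map_of_mem hx)
      · exact List.count_eq_zero.mp hd0.2 (List.mem_map_of_mem hx)
  have hQ : ∀ x ∈ D.word, IsOddCrossing D'.word x.label ↔ IsOddCrossing D.word x.label := by
    intro x hx
    have hx' : x ∈ u ++ v := h ▸ hx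
    have hx2 : x ∈ D'.word := by
      rw [h']
      simp only [List.mem_append] at hx' ⊢
      tauto
    refine isOddCrossing_congr (D'.count_label_eq_two hx2) (D.count_label_eq_two hx) ?_
    have hxc := (hl x hx').1.symm
    have hxd := (hl x hx').2.symm
    have h20 : (2 : ZMod 2) = 0 := rfl
    rw [h, h']
    simp only [positionSum_append, positionSum_orderedPair, count_label_orderedPair,
      List.length_append, length_orderedPair]
    have : (if o = 1 then (⟨false, d, -ε⟩ : GaussLetter) else ⟨false, c, ε⟩).label ≠ x.label := by
      split_ifs <;> assumption
    simp [positionSum, hxc, hxd, this, h20]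
  -- The two labels are adjacent on both strands, so their position sums differ by two odd numbers.
  have hP : IsOddCrossing D'.word c ↔ IsOddCrossing D'.word d := by
    refine isOddCrossing_congr hc hd ?_
    rw [h']
    simp only [positionSum_append, positionSum_orderedPair, count_label_orderedPair,
      List.length_append, length_orderedPair]
    rcases Int.units_eq_one_or o with rfl | rfl
    all_goals
      simp [positionSum, hcd, hdc, hc0, hd0, positionSum_eq_zero hc0.1, positionSum_eq_zero hc0.2,
        positionSum_eq_zero hd0.1, positionSum_eq_zero hd0.2] <;>
      grind
  rw [relationDet_eq s t z D.word, ← cyclicDet_transfer_congr s t z hQ, relationDet_eq]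
  have hn := D.nodup
  rw [h] at hn
  have key := cyclicDet_transfer_reidemeister2 (weight s t z (IsOddCrossing D'.word))
    (shear s t (IsOddCrossing D'.word)) (ε := ε) o hcd hn hl ?_ ?_ ?_
  · rwa [← h', ← h] at key
  · simp only [weight, hP]
    split_ifs <;> simp [← Units.val_mul]
  · simp only [weight, hP]
    split_ifs <;> simp [← Units.val_mul]
  · simp only [weight, shear, hP]
    have hs := s.mul_inv
    have ht := t.mul_inv
    by_cases hPd : IsOddCrossing D'.word d <;> rcases Int.units_eq_one_or ε with rfl | rfl <;>
      simp [hPd] <;> grind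

/-- With two odd crossings only the even one has a shear, and the powers of `z` met on the way to
and from it must balance. This is where opposite exponents on the over- and under-passage of an odd
crossing are used. -/
theorem relationDet_reidemeister3_conditions (P : ℕ → Prop) [DecidablePred P]
    (δ o₁ o₂ o₃ : ℤˣ) (a b c : ℕ)
    (hP : (¬ P a ∧ ¬ P b ∧ ¬ P c) ∨ (¬ P a ∧ P b ∧ P c) ∨ (P a ∧ ¬ P b ∧ P c) ∨
      (P a ∧ P b ∧ ¬ P c)) :
    let p := weight s t z P
    let k := shear s t P
    let α := δ * o₁ * o₂
    let β := δ * o₁ * o₃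
    let γ := δ * o₂ * o₃
    (k ⟨false, a, α⟩ * p ⟨true, c, γ⟩ * (if o₁ = o₂ then 1 else p ⟨true, b, β⟩) =
      k ⟨false, a, α⟩ * (if o₁ = o₂ then p ⟨true, b, β⟩ else 1)) ∧
    (k ⟨false, c, γ⟩ * (if o₂ = o₃ then p ⟨false, a, α⟩ else 1) =
      p ⟨false, b, β⟩ * k ⟨false, c, γ⟩ * (if o₂ = o₃ then 1 else p ⟨false, a, α⟩)) ∧
    ((if o₂ = o₃ then
        p ⟨false, c, γ⟩ * k ⟨false, b, β⟩ * (if o₁ = o₃ then p ⟨true, a, α⟩ else 1) +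
          k ⟨false, c, γ⟩ * k ⟨false, a, α⟩ * (if o₁ = o₂ then 1 else p ⟨true, b, β⟩)
      else
        p ⟨false, c, γ⟩ * k ⟨false, b, β⟩ * (if o₁ = o₃ then p ⟨true, a, α⟩ else 1)) =
      (if o₂ = o₃ then
        k ⟨false, b, β⟩ * (if o₁ = o₃ then 1 else p ⟨true, a, α⟩)
      else
        p ⟨false, b, β⟩ * k ⟨false, c, γ⟩ * k ⟨false, a, α⟩ *
          (if o₁ = o₂ then 1 else p ⟨true, b, β⟩) +
        k ⟨false, b, β⟩ * (if o₁ = o₃ then 1 else p ⟨true, a, α⟩))) := by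
  have d1 : (1 : ℤˣ) ≠ -1 := by decide
  have d2 : (-1 : ℤˣ) ≠ 1 := by decide
  have hs := s.mul_inv
  have ht := t.mul_inv
  have hz := z.mul_inv
  rcases Int.units_eq_one_or δ with rfl | rfl <;> rcases Int.units_eq_one_or o₁ with rfl | rfl <;>
    rcases Int.units_eq_one_or o₂ with rfl | rfl <;>
    rcases Int.units_eq_one_or o₃ with rfl | rfl <;>
    rcases hP with ⟨ha, hb, hc⟩ | ⟨ha, hb, hc⟩ | ⟨ha, hb, hc⟩ | ⟨ha, hb, hc⟩ <;>
    simp [weight, shear, ha, hb, hc, d1, d2] <;>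
    generalize ((s⁻¹ : Rˣ) : R) = s' at * <;>
    generalize ((t⁻¹ : Rˣ) : R) = t' at * <;>
    generalize ((z⁻¹ : Rˣ) : R) = z' at * <;>
    generalize (s : R) = s at * <;>
    generalize (t : R) = t at * <;>
    generalize (z : R) = z at * <;>
    grind

end Invariance

/-! ### The third Reidemeister move and invariance under all moves. -/

section Reidemeister3

variable {R : Type*} [CommRing R] (s t z : Rˣ)

theorem positionSum_orderedPair_neg (c : ℕ) (o : ℤˣ) (x y : GaussLetter) :
    positionSum c (orderedPair (-o) x y) = positionSum c (orderedPair o x y) +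
      (if x.label = c then 1 else 0) + (if y.label = c then 1 else 0) := by
  have h20 : (1 : ZMod 2) + 1 = 0 := rfl
  rw [positionSum_orderedPair, positionSum_orderedPair]
  rcases Int.units_eq_one_or o with rfl | rfl <;> simp <;> split_ifs <;> simp [h20]

theorem mem_orderedPair {o : ℤˣ} {a x y : GaussLetter} :
    a ∈ orderedPair o x y ↔ a = x ∨ a = y := by
  unfold orderedPair; split_ifs <;> simp [or_comm]

theorem relationDet_triangle (D D' : GaussCode) (δ o₁ o₂ o₃ : ℤˣ) (a b c : ℕ)
    (u v w : List GaussLetter)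
    (h : (D.word = topStrand δ o₁ o₂ o₃ a b ++ u ++ middleStrand δ o₁ o₂ o₃ a c ++ v ++
        bottomStrand δ o₁ o₂ o₃ b c ++ w ∧
      D'.word = topStrand δ (-o₁) (-o₂) (-o₃) a b ++ u ++ middleStrand δ (-o₁) (-o₂) (-o₃) a c ++
        v ++ bottomStrand δ (-o₁) (-o₂) (-o₃) b c ++ w) ∨
      (D.word = topStrand δ o₁ o₂ o₃ a b ++ u ++ bottomStrand δ o₁ o₂ o₃ b c ++ v ++
        middleStrand δ o₁ o₂ o₃ a c ++ w ∧
      D'.word = topStrand δ (-o₁) (-o₂) (-o₃) a b ++ u ++ bottomStrand δ (-o₁) (-o₂) (-o₃) b c ++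
        v ++ middleStrand δ (-o₁) (-o₂) (-o₃) a c ++ w)) :
    relationDet s t z D'.word = relationDet s t z D.word := by
  simp only [topStrand, middleStrand, bottomStrand, mul_neg, neg_mul, neg_neg] at h
  set α := δ * o₁ * o₂
  set β := δ * o₁ * o₃
  set γ := δ * o₂ * o₃
  have hcount : ∀ l, (D.word.map GaussLetter.label).count l =
      (u.map GaussLetter.label).count l + (v.map GaussLetter.label).count l +
      (w.map GaussLetter.label).count l + ((if a = l then 2 else 0) + (if b = l then 2 else 0) +
      (if c = l then 2 else 0)) := by
    intro l
    rcases h with ⟨h, -⟩ | ⟨h, -⟩ <;> rw [h] <;>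
      simp only [List.map_append, List.count_append, count_label_orderedPair] <;>
      split_ifs <;> ring
  have ha : a ≠ b ∧ a ≠ c := by
    have h1 := hcount a
    have h2 := D.count_label a
    split_ifs at h1 <;> omega
  have hbc : b ≠ c := by
    have h1 := hcount b
    have h2 := D.count_label b
    split_ifs at h1 <;> omega
  obtain ⟨hab, hac⟩ := ha
  have hba := hab.symm
  have hca := hac.symm
  have hcb := hbc.symm
  have h0 : ∀ l, l = a ∨ l = b ∨ l = c → (u.map GaussLetter.label).count l = 0 ∧
      (v.map GaussLetter.label).count l = 0 ∧ (w.map GaussLetter.label).count l = 0 := by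
    intro l hl
    have h1 := hcount l
    have h2 := D.count_label l
    rcases hl with rfl | rfl | rfl <;> simp [hab, hac, hbc, hba, hca, hcb] at h1 <;> omega
  have h2 : ∀ l, l = a ∨ l = b ∨ l = c → (D.word.map GaussLetter.label).count l = 2 := by
    intro l hl
    have h1 := hcount l
    have h2 := D.count_label l
    rcases hl with rfl | rfl | rfl <;> simp at h1 <;> omega
  have hl : ∀ x ∈ u ++ v ++ w, x.label ≠ a ∧ x.label ≠ b ∧ x.label ≠ c := by
    intro x hx
    have key : ¬ (x.label = a ∨ x.label = b ∨ x.label = c) := by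
      intro hx'
      obtain ⟨h1, h2, h3⟩ := h0 _ hx'
      simp only [List.mem_append] at hx
      rcases hx with (hx | hx) | hx
      · exact List.count_eq_zero.mp h1 (List.mem_map_of_mem hx)
      · exact List.count_eq_zero.mp h2 (List.mem_map_of_mem hx)
      · exact List.count_eq_zero.mp h3 (List.mem_map_of_mem hx)
    tauto
  have hperm : ∀ x, x ∈ D.word ↔ x ∈ D'.word := by
    intro x
    rcases h with ⟨h, h'⟩ | ⟨h, h'⟩ <;> rw [h, h'] <;>
      simp only [List.mem_append, mem_orderedPair]
  -- Each of the two letters of a triangle crossing moves by one position, so the sum keeps its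
  -- parity.
  have hsum : ∀ l, positionSum l D'.word = positionSum l D.word := by
    intro l
    have h20 : (2 : ZMod 2) = 0 := rfl
    rcases h with ⟨h, h'⟩ | ⟨h, h'⟩ <;> rw [h, h'] <;>
      simp only [positionSum_append, positionSum_orderedPair_neg, count_label_orderedPair,
        List.length_append, length_orderedPair] <;>
      linear_combination ((if a = l then 1 else 0) + (if b = l then 1 else 0) +
        (if c = l then 1 else 0)) * h20
  have hQ : ∀ x ∈ D.word, IsOddCrossing D.word x.label ↔ IsOddCrossing D'.word x.label :=
    fun x hx => isOddCrossing_congr (D.count_label_eq_two hx)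
      (D'.count_label_eq_two ((hperm x).mp hx)) (hsum _).symm
  -- The six letters fill three pairs of adjacent positions, each with odd sum. Hence zero or two of
  -- the three crossings are odd.
  have hP : positionSum a D.word + positionSum b D.word + positionSum c D.word = 1 := by
    obtain ⟨a1, a2, a3⟩ := h0 a (by simp)
    obtain ⟨b1, b2, b3⟩ := h0 b (by simp)
    obtain ⟨c1, c2, c3⟩ := h0 c (by simp)
    rcases h with ⟨h, -⟩ | ⟨h, -⟩ <;> rw [h] <;>
      simp only [positionSum_append, positionSum_orderedPair, count_label_orderedPair,
        List.length_append, length_orderedPair, positionSum_eq_zero, a1, a2, a3, b1, b2, b3, c1,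
        c2, c3] <;>
      rcases Int.units_eq_one_or o₁ with h₁ | h₁ <;> rcases Int.units_eq_one_or o₂ with h₂ | h₂ <;>
      rcases Int.units_eq_one_or o₃ with h₃ | h₃ <;>
      simp [h₁, h₂, h₃, hab, hac, hbc, hba, hca, hcb] <;> grind
  have hP' : ∀ l, l = a ∨ l = b ∨ l = c → (IsOddCrossing D.word l ↔ positionSum l D.word = 0) :=
    fun l hl => isOddCrossing_iff (h2 l hl)
  obtain ⟨h₁, h₂, h₃⟩ := relationDet_reidemeister3_conditions s t z (IsOddCrossing D.word)
    δ o₁ o₂ o₃ a b c (by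
      rw [hP' a (by simp), hP' b (by simp), hP' c (by simp)]
      generalize positionSum a D.word = x at hP
      generalize positionSum b D.word = y at hP
      generalize positionSum c D.word = z at hP
      revert x y z
      decide)
  obtain ⟨k₁, k₂⟩ := cyclicDet_transfer_reidemeister3 (weight s t z (IsOddCrossing D.word))
    (shear s t (IsOddCrossing D.word)) α β γ o₁ o₂ o₃ hab hac hbc hl h₁ h₂ h₃
  rw [relationDet_eq, relationDet_eq, ← cyclicDet_transfer_congr s t z
    (fun x hx => hQ x ((hperm x).mpr hx))]
  have hn := D.nodup
  rcases h with ⟨h, h'⟩ | ⟨h, h'⟩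
  · rw [← h, ← h'] at k₁
    exact (k₁ hn).symm
  · rw [← h, ← h'] at k₂
    exact (k₂ hn).symm

theorem relationDet_gaussMove {D D' : GaussCode} (h : GaussMove D.word D'.word) :
    ∃ a b : ℤ, relationDet s t z D'.word =
      ((s ^ a * t ^ b : Rˣ) : R) * relationDet s t z D.word := by
  have key : relationDet s t z D'.word = relationDet s t z D.word →
      ∃ a b : ℤ, relationDet s t z D'.word =
        ((s ^ a * t ^ b : Rˣ) : R) * relationDet s t z D.word :=
    fun h => ⟨0, 0, by simp [h]⟩
  suffices H : ∀ w w', GaussMove w w' → D.word = w → D'.word = w' →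
      ∃ a b : ℤ, relationDet s t z D'.word =
        ((s ^ a * t ^ b : Rˣ) : R) * relationDet s t z D.word from H _ _ h rfl rfl
  intro w w' h hw hw'
  cases h with
  | relabel φ => exact key (relationDet_relabel s t z D D' φ (by rw [hw', hw]))
  | rotate u v => exact key (relationDet_rotate s t z D D' u v hw hw')
  | reidemeister1 o c ε => exact relationDet_reidemeister1 s t z D D' o c ε (by rw [hw', hw])
  | reidemeister2 c d ε o u v =>
    exact key (relationDet_reidemeister2 s t z D D' c d ε o u v hw hw')
  | reidemeister3 δ o₁ o₂ o₃ a b c u v w =>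
    exact key (relationDet_triangle s t z D D' δ o₁ o₂ o₃ a b c u v w (.inl ⟨hw, hw'⟩))
  | reidemeister3' δ o₁ o₂ o₃ a b c u v w =>
    exact key (relationDet_triangle s t z D D' δ o₁ o₂ o₃ a b c u v w (.inr ⟨hw, hw'⟩))

end Reidemeister3

/-! ### Bounds on the exponents of Laurent polynomials. -/

section Exponents

open LaurentPolynomial

/-- The exponents that appear in `f` lie between `-m` and `n`. -/
def ExponentsIn {A : Type*} [CommRing A] (m n : ℕ) (f : A[T;T⁻¹]) : Prop :=
  ∀ i, f.coeff i ≠ 0 → -(m : ℤ) ≤ i ∧ i ≤ n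

variable {A : Type*} [CommRing A]

theorem exponentsIn_zero (m n : ℕ) : ExponentsIn m n (0 : A[T;T⁻¹]) :=
  fun i hi => absurd (by simp) hi

theorem exponentsIn_C (a : A) (m n : ℕ) : ExponentsIn m n (C a) := by
  intro i hi
  have : i = 0 := by by_contra h; simp [C_apply, h] at hi
  omega

theorem exponentsIn_one (m n : ℕ) : ExponentsIn m n (1 : A[T;T⁻¹]) := by
  rw [← map_one C]; exact exponentsIn_C 1 m n

theorem exponentsIn_T {m n : ℕ} {k : ℤ} (h : -(m : ℤ) ≤ k ∧ k ≤ n) :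
    ExponentsIn m n (T k : A[T;T⁻¹]) := by
  intro i hi
  have : k = i := by by_contra h; simp [T_apply, h] at hi
  omega

theorem ExponentsIn.add {m n : ℕ} {f g : A[T;T⁻¹]} (hf : ExponentsIn m n f)
    (hg : ExponentsIn m n g) : ExponentsIn m n (f + g) := by
  intro i hi
  by_cases h : f.coeff i = 0
  · exact hg i fun h' => hi (by simp [h, h'])
  · exact hf i h

theorem ExponentsIn.neg {m n : ℕ} {f : A[T;T⁻¹]} (hf : ExponentsIn m n f) :
    ExponentsIn m n (-f) :=
  fun i hi => hf i fun h => hi (by simp [h])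

theorem ExponentsIn.sum {ι : Type*} {m n : ℕ} {f : ι → A[T;T⁻¹]} {S : Finset ι}
    (hf : ∀ i ∈ S, ExponentsIn m n (f i)) : ExponentsIn m n (∑ i ∈ S, f i) :=
  Finset.sum_induction _ _ (fun _ _ => ExponentsIn.add) (exponentsIn_zero m n) hf

theorem ExponentsIn.mul {m n m' n' : ℕ} {f g : A[T;T⁻¹]} (hf : ExponentsIn m n f)
    (hg : ExponentsIn m' n' g) : ExponentsIn (m + m') (n + n') (f * g) := by
  intro i hi
  have h1 := AddMonoidAlgebra.support_coeff_mul_subset f g (Finsupp.mem_support_iff.mpr hi)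
  obtain ⟨a, ha, b, hb, rfl⟩ := Finset.mem_add.mp h1
  have := hf a (Finsupp.mem_support_iff.mp ha)
  have := hg b (Finsupp.mem_support_iff.mp hb)
  push_cast
  omega

theorem ExponentsIn.prod {ι : Type*} {m n : ι → ℕ} {f : ι → A[T;T⁻¹]} {S : Finset ι}
    (hf : ∀ i ∈ S, ExponentsIn (m i) (n i) (f i)) :
    ExponentsIn (∑ i ∈ S, m i) (∑ i ∈ S, n i) (∏ i ∈ S, f i) := by
  classical
  induction S using Finset.induction_on with
  | empty => exact exponentsIn_one _ _
  | insert a S ha ih =>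
    rw [Finset.sum_insert ha, Finset.sum_insert ha, Finset.prod_insert ha]
    exact (hf a (by simp)).mul (ih fun i hi => hf i (by simp [hi]))

theorem exponentsIn_det {ι : Type*} [Fintype ι] [DecidableEq ι] {M : Matrix ι ι A[T;T⁻¹]}
    {m n : ι → ℕ} (h : ∀ i j, ExponentsIn (m i) (n i) (M i j)) :
    ExponentsIn (∑ i, m i) (∑ i, n i) M.det := by
  -- Transposing makes the product run over rows, which is how the bounds are indexed.
  rw [← Matrix.det_transpose, Matrix.det_apply]
  refine ExponentsIn.sum fun σ _ => ?_
  have := ExponentsIn.prod (S := Finset.univ) fun i _ => h i (σ i)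
  rcases Int.units_eq_one_or (Equiv.Perm.sign σ) with h | h <;> rw [h]
  · simpa using this
  · simpa using this.neg

theorem ExponentsIn.mono {m n m' n' : ℕ} {f : A[T;T⁻¹]} (hf : ExponentsIn m n f) (hm : m ≤ m')
    (hn : n ≤ n') : ExponentsIn m' n' f := by
  intro i hi
  have := hf i hi
  omega

theorem zExponent_le {f : LaurentSTZ} {n : ℕ} (h : ExponentsIn n n f) : zExponent f ≤ n := by
  refine Finset.sup_le fun i hi => ?_
  have := h i (Finsupp.mem_support_iff.mp hi)
  omega

theorem zExponent_C_mul (c : (ℤ[T;T⁻¹][T;T⁻¹])ˣ) (f : LaurentSTZ) :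
    zExponent (C (c : ℤ[T;T⁻¹][T;T⁻¹]) * f) = zExponent f := by
  unfold zExponent
  congr 1
  ext i
  simp only [Finsupp.mem_support_iff]
  rw [← smul_eq_C_mul]
  simp

end Exponents

/-! ### Exponents of `z` in the determinant and the bound for a diagram. -/

section Bound

open LaurentPolynomial

theorem laurentVar_zpow (A : Type*) [CommRing A] (k : ℤ) :
    ((laurentVar A ^ k : (A[T;T⁻¹])ˣ) : A[T;T⁻¹]) = T k := by
  have h1 : ((laurentVar A : (A[T;T⁻¹])ˣ) : A[T;T⁻¹]) = T 1 := rfl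
  have h2 : (((laurentVar A)⁻¹ : (A[T;T⁻¹])ˣ) : A[T;T⁻¹]) = T (-1) := rfl
  cases k with
  | ofNat n => rw [Int.ofNat_eq_natCast, zpow_natCast, Units.val_pow_eq_pow_val, h1, T_pow, mul_one]
  | negSucc n =>
    rw [zpow_negSucc, ← inv_pow, Units.val_pow_eq_pow_val, h2, T_pow, Int.negSucc_eq]
    congr 1
    push_cast
    ring

/-- Whether the passage `x` contributes a factor with exponent `η`, where `P` holds at the odd
crossings. -/
def shift (P : ℕ → Prop) [DecidablePred P] (η : ℤˣ) (x : GaussLetter) : ℕ :=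
  if P x.label ∧ (x.isOver = true ↔ x.sign = η) then 1 else 0

theorem exponentsIn_relationMatrix {A : Type*} [CommRing A] {s t : (A[T;T⁻¹])ˣ}
    (h : ∀ a b : ℤ, ∃ c : A, ((s ^ a * t ^ b : (A[T;T⁻¹])ˣ) : A[T;T⁻¹]) = C c)
    (w : List GaussLetter) (x y : {x // x ∈ w}) :
    ExponentsIn (shift (IsOddCrossing w) (-1) x.1) (shift (IsOddCrossing w) 1 x.1)
      (relationMatrix s t (laurentVar A) w x y) := by
  obtain ⟨⟨o, l, ε⟩, hx⟩ := x
  have d1 : (1 : ℤˣ) ≠ -1 := by decide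
  have d2 : (-1 : ℤˣ) ≠ 1 := by decide
  obtain ⟨cs, hs⟩ := h ε 0
  obtain ⟨ct, ht⟩ := h 0 ε
  obtain ⟨cst, hst⟩ := h ε ε
  rw [zpow_zero, mul_one] at hs
  rw [zpow_zero, one_mul] at ht
  unfold relationMatrix
  rw [Matrix.of_apply, sub_eq_add_neg]
  refine ExponentsIn.add ?_ (ExponentsIn.neg ?_)
  · by_cases hP : IsOddCrossing w l
    · have hT : ∀ (p : Prop) [Decidable p] (m n : ℕ) (k : ℤ), -(m : ℤ) ≤ k ∧ k ≤ n →
          ExponentsIn m n (if p then (T k : A[T;T⁻¹]) else 0) := by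
        intro p _ m n k hk
        split_ifs
        · exact exponentsIn_T hk
        · exact exponentsIn_zero m n
      rw [if_pos hP]
      cases o
      · rw [if_neg (by simp), laurentVar_zpow]
        apply hT
        rcases Int.units_eq_one_or ε with rfl | rfl <;> simp [shift, hP, d1, d2]
      · rw [if_pos (by simp), laurentVar_zpow]
        apply hT
        rcases Int.units_eq_one_or ε with rfl | rfl <;> simp [shift, hP, d1, d2]
    · have hC : ∀ (p : Prop) [Decidable p] (m n : ℕ) (c : A),
          ExponentsIn m n (if p then C c else 0) := by
        intro p _ m n c
        split_ifs
        · exact exponentsIn_C c m n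
        · exact exponentsIn_zero m n
      rw [if_neg hP, hs, ht, hst, ← map_one C, ← map_sub]
      split_ifs with ho
      · exact exponentsIn_C _ _ _
      · exact exponentsIn_zero _ _
      all_goals
        simp only [add_zero, zero_add, ← map_add]
        first | exact exponentsIn_C _ _ _ | exact exponentsIn_zero _ _
  · split_ifs
    · exact exponentsIn_one _ _
    · exact exponentsIn_zero _ _

/-- The two passages of a crossing share their sign, so for given `η` at most one of them counts,
and it is determined by the label. -/
theorem GaussCode.sum_shift_le_numOdd (D : GaussCode) (η : ℤˣ) :
    ∑ x : {x // x ∈ D.word}, shift (IsOddCrossing D.word) η x.1 ≤ D.numOdd := by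
  unfold shift
  rw [← Finset.card_filter]
  refine Finset.card_le_card_of_injOn (fun x => x.1.label) ?_ ?_
  · intro x hx
    rw [Finset.mem_coe, Finset.mem_filter] at hx
    rw [Finset.mem_coe, Finset.mem_filter, List.mem_toFinset]
    exact ⟨List.mem_map_of_mem x.2, hx.2.1⟩
  · intro x hx y hy hxy
    rw [Finset.mem_coe, Finset.mem_filter] at hx hy
    have hs := D.sign_eq_of_label_eq x.2 y.2 hxy
    refine Subtype.ext (GaussLetter.ext ?_ hxy hs)
    rw [Bool.eq_iff_iff, hx.2.2, hy.2.2, hs]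

theorem exists_C_eq (a b : ℤ) : ∃ c : (ℤ[T;T⁻¹][T;T⁻¹])ˣ,
    ((varS ^ a * varT ^ b : LaurentSTZˣ) : LaurentSTZ) = C (c : ℤ[T;T⁻¹][T;T⁻¹]) := by
  let φ := Units.map (C : ℤ[T;T⁻¹][T;T⁻¹] →+* LaurentSTZ).toMonoidHom
  let x := Units.map (C : ℤ[T;T⁻¹] →+* ℤ[T;T⁻¹][T;T⁻¹]).toMonoidHom (laurentVar ℤ)
  let y := laurentVar ℤ[T;T⁻¹]
  refine ⟨x ^ a * y ^ b, ?_⟩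
  have h : φ (x ^ a * y ^ b) = φ x ^ a * φ y ^ b :=
    (map_mul φ _ _).trans (congrArg₂ _ (map_zpow φ x a) (map_zpow φ y b))
  exact congrArg Units.val h.symm

theorem GaussCode.zExponent_le_numOdd (D : GaussCode) :
    zExponent D.zParityPolynomial ≤ D.numOdd := by
  unfold zParityPolynomial
  split_ifs with h
  · simp [zExponent]
  · exact zExponent_le ((exponentsIn_det (exponentsIn_relationMatrix
      (fun a b => (exists_C_eq a b).imp' _ fun _ => id) D.word)).mono
      (D.sum_shift_le_numOdd (-1)) (D.sum_shift_le_numOdd 1))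

theorem GaussCode.zExponent_eq_of_eqvGen {D D' : GaussCode}
    (h : Relation.EqvGen (fun D D' : GaussCode => GaussMove D.word D'.word) D D') :
    zExponent D.zParityPolynomial = zExponent D'.zParityPolynomial := by
  induction h with
  | rel D D' h =>
    obtain ⟨a, b, hab⟩ := relationDet_gaussMove (R := LaurentSTZ) varS varT varZ h
    obtain ⟨c, hc⟩ := exists_C_eq a b
    change D'.zParityPolynomial = _ * D.zParityPolynomial at hab
    rw [hab, hc, zExponent_C_mul]
  | refl => rfl
  | symm _ _ _ ih => exact ih.symm
  | trans _ _ _ _ _ ih ih' => exact ih.trans ih'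

end Bound

theorem mainTheorem2 (K : VirtualKnot) (f : LaurentSTZ)
    (hf : K.IsZParityAlexanderPolynomial f) :
    zExponent f ≤ K.minOdd ∧ (Odd (zExponent f) → zExponent f + 1 ≤ K.minOdd) := by
  obtain ⟨D, hD, ε, a, b, rfl⟩ := hf
  -- The infimum is attained by a diagram, which supplies both the bound and the evenness of the
  -- minimum.
  obtain ⟨D', hD', hmin⟩ := Nat.sInf_mem
    (⟨D.numOdd, D, hD, rfl⟩ : {n : ℕ | ∃ D : GaussCode, K.IsDiagram D ∧ D.numOdd = n}.Nonempty)
  obtain ⟨c, hc⟩ := exists_C_eq a b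
  have hε : ((ε : ℤ) : LaurentSTZ) = LaurentPolynomial.C
      ((Units.map (Int.castRingHom ℤ[T;T⁻¹][T;T⁻¹]).toMonoidHom ε : (ℤ[T;T⁻¹][T;T⁻¹])ˣ) :
        ℤ[T;T⁻¹][T;T⁻¹]) := by
    simp
  rw [hc, hε, mul_assoc, zExponent_C_mul, zExponent_C_mul,
    GaussCode.zExponent_eq_of_eqvGen (Quot.eqvGen_exact (hD.trans hD'.symm))]
  have hle : zExponent D'.zParityPolynomial ≤ K.minOdd :=
    D'.zExponent_le_numOdd.trans_eq hmin
  refine ⟨hle, fun hodd => ?_⟩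
  have heven : Even K.minOdd := by
    have := D'.even_numOdd
    rwa [hmin] at this
  rw [Nat.odd_iff] at hodd
  rw [Nat.even_iff] at heven
  omega
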